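/- Let $F$ be any field. Identify $\mathrm{AGL}_4(F)$ with the group of invertible $5\times5$ matrices over $F$ with first column $(1,0,0,0,0)^{T}$. A subgroup $R\le \mathrm{AGL}_4(F)$ is \emph{regular} if for every $v\in F^4$ there is exactly one element of $R$ with first row $(1,v)$; write this element as $\begin{pmatrix}1&v\\0&I_4+\delta_R(v)\end{pmatrix}$. Let $\Delta_4(F)$ be the set of regular subgroups $R$ for which $\delta_R:F^4\to \mathrm{Mat}_4(F)$ is linear. A matrix depending on $x_1,x_2,x_3,x_4$ below denotes the set of its values as $x_1,\dots,x_4$ range over $F$; all these sets are subgroups of $\mathrm{AGL}_4(F)$: $$U_2(\alpha_1,\alpha_3,\gamma_1,\gamma_3,\zeta)=\begin{pmatrix}1&x_1&x_2&x_3&x_4\\0&1&\zeta x_1&0&\alpha_1x_1+x_2+\alpha_3x_3\\0&0&1&0&x_1\\0&0&0&1&\gamma_1x_1+\gamma_3x_3\\0&0&0&0&1\end{pmatrix},\quad U_3(\alpha_3,\gamma_1,\gamma_3)=\begin{pmatrix}1&x_1&x_2&x_3&x_4\\0&1&x_1&0&\alpha_3x_3\\0&0&1&0&0\\0&0&0&1&\gamma_1x_1+\gamma_3x_3\\0&0&0&0&1\end{pmatrix},$$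 $$U_4(\rho,\beta_1,\beta_2)=\begin{pmatrix}1&x_1&x_2&x_3&x_4\\0&1&0&x_1&x_2\\0&0&1&\rho x_2&\beta_1x_1+\beta_2x_2\\0&0&0&1&0\\0&0&0&0&1\end{pmatrix},\quad U_5(\alpha_1,\alpha_2,\beta_2)=\begin{pmatrix}1&x_1&x_2&x_3&x_4\\0&1&0&x_2&\alpha_1x_1+\alpha_2x_2\\0&0&1&x_1&\beta_2x_2\\0&0&0&1&0\\0&0&0&0&1\end{pmatrix},$$ and, for $D\in\mathrm{Mat}_3(F)$, $$R_D=\left\{\begin{pmatrix}1&X&x_4\\0&I_3&DX^{T}\\0&0&1\end{pmatrix}: X=(x_1,x_2,x_3)\in F^3,\ x_4\in F\right\}.$$ Fix the following sets of representatives. \begin{itemize} \item $F^\square$: a transversal for $(F^{*})^2$ in $F^{*}$. \item For each $\rho\in F^\square$, $\mathsf A_\rho(F)$: a set of representatives for the equivalence relation on $(F\setminus\{1\})\times F$ under which $(\beta_1,\beta_2)$ and $(\beta_3,\beta_4)$ are equivalent if and only if either $(\beta_3,\beta_4)=(\beta_1,\pm\beta_2)$, or $$\beta_3=\frac{\beta_1t^2+\beta_2t-\rho}{t^2+\beta_2t-\rho\beta_1},\qquad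 \beta_4=\pm\frac{\beta_2t^2-2\rho(\beta_1+1)t-\rho\beta_2}{t^2+\beta_2t-\rho\beta_1}$$ for some $t\in F$ with $(t^2+\rho)(t^2+\beta_2t-\rho\beta_1)\ne0$. \item If $\operatorname{char}F=2$, $\mathsf B(F)$: a transversal in $F$ for the additive subgroup $\{\lambda^2+\lambda:\lambda\in F\}$. \item $\Pi_A(F)$: a set of representatives for the non-symmetric matrices in $\mathrm{Mat}_3(F)$ up to projective congruence, where $A$ and $B$ are projectively congruent if $PAP^{T}=\lambda B$ for some $P\in\mathrm{GL}_3(F)$ and $\lambda\in F^{*}$. \end{itemize} Then the following subgroups are nonabelian and belong to $\Delta_4(F)$, and every nonabelian subgroup in $\Delta_4(F)$ is conjugate in $\mathrm{AGL}_4(F)$ to exactly one of them (in particular, no two subgroups corresponding to different entries or different parameters are conjugate): \begin{itemize} \item $U_2(0,1,0,1,1)$, $U_2(0,1,0,0,1)$, $U_3(0,1,0)$ and $U_3(0,1,1)$; \item $U_3(1,\lambda,0)$ with $\lambda\in F\setminus\{1\}$; \item $U_4(\rho,\beta_1,\beta_2)$ with $\rho\in F^\square$ and $(\beta_1,\beta_2)\in\mathsf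 A_\rho(F)$; \item $U_5(1,1,\epsilon)$ with $\epsilon\in\mathsf B(F)$, only if $\operatorname{char}F=2$; \item $R_D$ with $D\in\Pi_A(F)$. \end{itemize} -/

import Mathlib

namespace NilpAlg

/-- The affine group `AGL_n(F)`, identified with the group of invertible `(n+1) × (n+1)` matrices
whose first column is `(1, 0, …, 0)ᵀ`. -/
def AGL (n : ℕ) (F : Type*) [Field F] :
    Subgroup (Matrix.GeneralLinearGroup (Fin (n + 1)) F) where
  carrier := {g | ∀ i, g.1 i 0 = if i = 0 then 1 else 0}
  one_mem' := by
    intro i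
    simp [Matrix.one_apply]
  mul_mem' := by
    intro a b ha hb i
    have h : ∀ k, b.1 k 0 = if k = 0 then 1 else 0 := hb
    have h' : a.1 i 0 = if i = 0 then 1 else 0 := ha i
    simp [Matrix.mul_apply, h, h']
  inv_mem' := by
    intro a ha i
    have h : ∀ k, a.1 k 0 = if k = 0 then 1 else 0 := ha
    have h1 : (a⁻¹.1 * a.1) i 0 = (1 : Matrix (Fin (n + 1)) (Fin (n + 1)) F) i 0 := by
      rw [← Units.val_mul, inv_mul_cancel, Units.val_one]
    simpa [Matrix.mul_apply, h, Matrix.one_apply] using h1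

/-- `R ≤ AGL_n(F)` is regular: for every `v ∈ F^n` there is a unique element of `R` whose first
row is `(1, v)`; that is, `R` acts regularly on the right on the affine points `(1, v)`. -/
def IsRegular {n : ℕ} {F : Type*} [Field F]
    (R : Subgroup (Matrix.GeneralLinearGroup (Fin (n + 1)) F)) : Prop :=
  R ≤ AGL n F ∧ ∀ v : Fin n → F, ∃! r, r ∈ R ∧ r.1 0 = Matrix.vecCons 1 v

/-- `Δ_n(F)`: the regular subgroups `R` of `AGL_n(F)` for which the function `δ_R`, determined by
`r = (1, v; 0, I_n + δ_R(v))` for `r ∈ R`, is linear. -/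
def Delta (n : ℕ) (F : Type*) [Field F] :
    Set (Subgroup (Matrix.GeneralLinearGroup (Fin (n + 1)) F)) :=
  {R | IsRegular R ∧ ∃ δ : (Fin n → F) →ₗ[F] Matrix (Fin n) (Fin n) F,
    ∀ r ∈ R, r.1.submatrix Fin.succ Fin.succ = 1 + δ (fun j => r.1 0 j.succ)}

/-- Conjugacy of subgroups under the affine group `AGL_n(F)`. -/
def AffConj {n : ℕ} {F : Type*} [Field F]
    (R S : Subgroup (Matrix.GeneralLinearGroup (Fin (n + 1)) F)) : Prop :=
  ∃ g ∈ AGL n F, S = R.map (MulAut.conj g).toMonoidHom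

/-- The subgroup is nonabelian. -/
def IsNonabelian {G : Type*} [Group G] (R : Subgroup G) : Prop :=
  ∃ a ∈ R, ∃ b ∈ R, a * b ≠ b * a

/-- The group of all invertible matrices `M x` (`x ∈ F^4`) of a parametrized family of matrices
that is closed under products and inverses. -/
def ofFamily {F : Type*} [Field F] (M : F → F → F → F → Matrix (Fin 5) (Fin 5) F)
    (h1 : M 0 0 0 0 = 1)
    (hmul : ∀ a b c d a' b' c' d', ∃ x y z t, M a b c d * M a' b' c' d' = M x y z t)
    (hinv : ∀ a b c d, ∃ x y z t, M a b c d * M x y z t = 1) :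
    Subgroup (Matrix.GeneralLinearGroup (Fin 5) F) where
  carrier := {g | ∃ x₁ x₂ x₃ x₄, g.1 = M x₁ x₂ x₃ x₄}
  one_mem' := ⟨0, 0, 0, 0, h1.symm⟩
  mul_mem' := by
    rintro g h ⟨a, b, c, d, hg⟩ ⟨a', b', c', d', hh⟩
    obtain ⟨x, y, z, t, e⟩ := hmul a b c d a' b' c' d'
    exact ⟨x, y, z, t, by rw [Units.val_mul, hg, hh, e]⟩
  inv_mem' := by
    rintro g ⟨a, b, c, d, hg⟩
    obtain ⟨x, y, z, t, e⟩ := hinv a b c d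
    refine ⟨x, y, z, t, ?_⟩
    rw [← hg] at e
    calc g⁻¹.1 = g⁻¹.1 * (g.1 * M x y z t) := by rw [e, mul_one]
      _ = M x y z t := by rw [← mul_assoc, ← Units.val_mul, inv_mul_cancel, Units.val_one, one_mul]

/-- `U_2(α₁, α₃, γ₁, γ₃, ζ)`. -/
def U2 {F : Type*} [Field F] (α₁ α₃ γ₁ γ₃ ζ : F) :
    Subgroup (Matrix.GeneralLinearGroup (Fin 5) F) :=
  ofFamily (fun x₁ x₂ x₃ x₄ =>
    !![1, x₁, x₂, x₃, x₄;
       0, 1, ζ * x₁, 0, α₁ * x₁ + x₂ + α₃ * x₃;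
       0, 0, 1, 0, x₁;
       0, 0, 0, 1, γ₁ * x₁ + γ₃ * x₃;
       0, 0, 0, 0, 1])
    (by ext i j; fin_cases i <;> fin_cases j <;> simp)
    (by
      intro a b c d a' b' c' d'
      refine ⟨a + a', b + b' + ζ * a * a', c + c',
        d' + a * (α₁ * a' + b' + α₃ * c') + b * a' + c * (γ₁ * a' + γ₃ * c') + d, ?_⟩
      ext i j
      fin_cases i <;> fin_cases j <;> simp [Matrix.mul_apply, Fin.sum_univ_succ] <;> ring)
    (by
      intro a b c d
      refine ⟨-a, -b + ζ * a * a, -c,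
        -(a * (α₁ * (-a) + (-b + ζ * a * a) + α₃ * (-c)) + b * (-a)
          + c * (γ₁ * (-a) + γ₃ * (-c)) + d), ?_⟩
      ext i j
      fin_cases i <;> fin_cases j <;> simp [Matrix.mul_apply, Fin.sum_univ_succ] <;> ring)

/-- `U_3(α₃, γ₁, γ₃)`. -/
def U3 {F : Type*} [Field F] (α₃ γ₁ γ₃ : F) :
    Subgroup (Matrix.GeneralLinearGroup (Fin 5) F) :=
  ofFamily (fun x₁ x₂ x₃ x₄ =>
    !![1, x₁, x₂, x₃, x₄;
       0, 1, x₁, 0, α₃ * x₃;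
       0, 0, 1, 0, 0;
       0, 0, 0, 1, γ₁ * x₁ + γ₃ * x₃;
       0, 0, 0, 0, 1])
    (by ext i j; fin_cases i <;> fin_cases j <;> simp)
    (by
      intro a b c d a' b' c' d'
      refine ⟨a + a', b + b' + a * a', c + c',
        d' + a * (α₃ * c') + c * (γ₁ * a' + γ₃ * c') + d, ?_⟩
      ext i j
      fin_cases i <;> fin_cases j <;> simp [Matrix.mul_apply, Fin.sum_univ_succ] <;> ring)
    (by
      intro a b c d
      refine ⟨-a, -b + a * a, -c,
        -(a * (α₃ * (-c)) + c * (γ₁ * (-a) + γ₃ * (-c)) + d), ?_⟩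
      ext i j
      fin_cases i <;> fin_cases j <;> simp [Matrix.mul_apply, Fin.sum_univ_succ] <;> ring)

/-- `U_4(ρ, β₁, β₂)`. -/
def U4 {F : Type*} [Field F] (ρ β₁ β₂ : F) :
    Subgroup (Matrix.GeneralLinearGroup (Fin 5) F) :=
  ofFamily (fun x₁ x₂ x₃ x₄ =>
    !![1, x₁, x₂, x₃, x₄;
       0, 1, 0, x₁, x₂;
       0, 0, 1, ρ * x₂, β₁ * x₁ + β₂ * x₂;
       0, 0, 0, 1, 0;
       0, 0, 0, 0, 1])
    (by ext i j; fin_cases i <;> fin_cases j <;> simp)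
    (by
      intro a b c d a' b' c' d'
      refine ⟨a + a', b + b', c + c' + a * a' + b * (ρ * b'),
        d + d' + a * b' + b * (β₁ * a' + β₂ * b'), ?_⟩
      ext i j
      fin_cases i <;> fin_cases j <;> simp [Matrix.mul_apply, Fin.sum_univ_succ] <;> ring)
    (by
      intro a b c d
      refine ⟨-a, -b, -c + a * a + b * (ρ * b),
        -d + a * b + b * (β₁ * a + β₂ * b), ?_⟩
      ext i j
      fin_cases i <;> fin_cases j <;> simp [Matrix.mul_apply, Fin.sum_univ_succ] <;> ring)

/-- `U_5(α₁, α₂, β₂)`. -/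
def U5 {F : Type*} [Field F] (α₁ α₂ β₂ : F) :
    Subgroup (Matrix.GeneralLinearGroup (Fin 5) F) :=
  ofFamily (fun x₁ x₂ x₃ x₄ =>
    !![1, x₁, x₂, x₃, x₄;
       0, 1, 0, x₂, α₁ * x₁ + α₂ * x₂;
       0, 0, 1, x₁, β₂ * x₂;
       0, 0, 0, 1, 0;
       0, 0, 0, 0, 1])
    (by ext i j; fin_cases i <;> fin_cases j <;> simp)
    (by
      intro a b c d a' b' c' d'
      refine ⟨a + a', b + b', c + c' + a * b' + b * a',
        d + d' + a * (α₁ * a' + α₂ * b') + b * (β₂ * b'), ?_⟩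
      ext i j
      fin_cases i <;> fin_cases j <;> simp [Matrix.mul_apply, Fin.sum_univ_succ] <;> ring)
    (by
      intro a b c d
      refine ⟨-a, -b, -c + a * b + b * a,
        -d + a * (α₁ * a + α₂ * b) + b * (β₂ * b), ?_⟩
      ext i j
      fin_cases i <;> fin_cases j <;> simp [Matrix.mul_apply, Fin.sum_univ_succ] <;> ring)

/-- `R_D`, for a `3 × 3` matrix `D`: the matrices `(1, X, x₄; 0, I_3, D Xᵀ; 0, 0, 1)` with
`X = (x₁, x₂, x₃)`. -/
def RD {F : Type*} [Field F] (D : Matrix (Fin 3) (Fin 3) F) :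
    Subgroup (Matrix.GeneralLinearGroup (Fin 5) F) :=
  ofFamily (fun x₁ x₂ x₃ x₄ =>
    !![1, x₁, x₂, x₃, x₄;
       0, 1, 0, 0, D 0 0 * x₁ + D 0 1 * x₂ + D 0 2 * x₃;
       0, 0, 1, 0, D 1 0 * x₁ + D 1 1 * x₂ + D 1 2 * x₃;
       0, 0, 0, 1, D 2 0 * x₁ + D 2 1 * x₂ + D 2 2 * x₃;
       0, 0, 0, 0, 1])
    (by ext i j; fin_cases i <;> fin_cases j <;> simp)
    (by
      intro a b c d a' b' c' d'
      refine ⟨a + a', b + b', c + c',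
        d + d' + a * (D 0 0 * a' + D 0 1 * b' + D 0 2 * c')
          + b * (D 1 0 * a' + D 1 1 * b' + D 1 2 * c')
          + c * (D 2 0 * a' + D 2 1 * b' + D 2 2 * c'), ?_⟩
      ext i j
      fin_cases i <;> fin_cases j <;> simp [Matrix.mul_apply, Fin.sum_univ_succ] <;> ring)
    (by
      intro a b c d
      refine ⟨-a, -b, -c,
        -d + a * (D 0 0 * a + D 0 1 * b + D 0 2 * c)
          + b * (D 1 0 * a + D 1 1 * b + D 1 2 * c)
          + c * (D 2 0 * a + D 2 1 * b + D 2 2 * c), ?_⟩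
      ext i j
      fin_cases i <;> fin_cases j <;> simp [Matrix.mul_apply, Fin.sum_univ_succ] <;> ring)

/-- `S` is a complete set of representatives for the relation `r` on the set `X`: a subset of `X`
such that each element of `X` is related to exactly one element of `S`. -/
def IsRepSet {α : Type*} (X : Set α) (r : α → α → Prop) (S : Set α) : Prop :=
  S ⊆ X ∧ ∀ x ∈ X, ∃! s, s ∈ S ∧ r x s

/-- Same coset of the group of nonzero squares. -/
def SquareRel {F : Type*} [Field F] (a b : F) : Prop :=
  ∃ c : F, c ≠ 0 ∧ a = b * c ^ 2

/-- Same coset of `{c² + c : c ∈ F}` (used in characteristic 2). -/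
def ArtinSchreierRel {F : Type*} [Field F] (a b : F) : Prop :=
  ∃ c : F, a = b + (c ^ 2 + c)

/-- The relation `⋇_ρ` on `(F ∖ {1}) × F`. -/
def DivRel {F : Type*} [Field F] (ρ : F) (p q : F × F) : Prop :=
  (q.1 = p.1 ∧ (q.2 = p.2 ∨ q.2 = -p.2)) ∨
  ∃ t : F, (t ^ 2 + ρ) * (t ^ 2 + p.2 * t - ρ * p.1) ≠ 0 ∧
    q.1 = (p.1 * t ^ 2 + p.2 * t - ρ) / (t ^ 2 + p.2 * t - ρ * p.1) ∧
    (q.2 = (p.2 * t ^ 2 - 2 * ρ * (p.1 + 1) * t - ρ * p.2) / (t ^ 2 + p.2 * t - ρ * p.1) ∨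
     q.2 = -((p.2 * t ^ 2 - 2 * ρ * (p.1 + 1) * t - ρ * p.2) / (t ^ 2 + p.2 * t - ρ * p.1)))

/-- Projective congruence of square matrices. -/
def ProjCongruent {n : ℕ} {F : Type*} [Field F] (A B : Matrix (Fin n) (Fin n) F) : Prop :=
  ∃ (P : Matrix.GeneralLinearGroup (Fin n) F) (c : F), c ≠ 0 ∧
    P.1 * A * P.1.transpose = c • B

/-- Labels of the subgroups in the table. -/
inductive Label (F : Type*) where
  | u2_one : Label F
  | u2_zero : Label F
  | u3_zero : Label F
  | u3_one : Label F
  | u3_lam (lam : F) : Label F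
  | u4 (ρ β₁ β₂ : F) : Label F
  | u5 (ε : F) : Label F
  | rd (D : Matrix (Fin 3) (Fin 3) F) : Label F

/-- The subgroup with a given label. -/
def Label.group {F : Type*} [Field F] : Label F → Subgroup (Matrix.GeneralLinearGroup (Fin 5) F)
  | .u2_one => U2 0 1 0 1 1
  | .u2_zero => U2 0 1 0 0 1
  | .u3_zero => U3 0 1 0
  | .u3_one => U3 0 1 1
  | .u3_lam lam => U3 1 lam 0
  | .u4 ρ β₁ β₂ => U4 ρ β₁ β₂
  | .u5 ε => U5 1 1 ε
  | .rd D => RD D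

/-- The conditions on the parameters in the table, relative to a choice of sets of representatives
`Q` (nonzero elements modulo squares), `A ρ` (for `⋇_ρ`), `B` (modulo `{c² + c}`) and `P`
(asymmetric matrices up to projective congruence). -/
def Label.Cond {F : Type*} [Field F] (Q : Set F) (A : F → Set (F × F)) (B : Set F)
    (P : Set (Matrix (Fin 3) (Fin 3) F)) : Label F → Prop
  | .u2_one => True
  | .u2_zero => True
  | .u3_zero => True
  | .u3_one => True
  | .u3_lam lam => lam ≠ 1
  | .u4 ρ β₁ β₂ => ρ ∈ Q ∧ (β₁, β₂) ∈ A ρ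
  | .u5 ε => CharP F 2 ∧ ε ∈ B
  | .rd D => D ∈ P

end NilpAlg

/-! A regular subgroup with linear `δ` is the same thing as a bilinear product `m u v = u δ(v)`: its
elements are the affine maps `u ↦ u + v + m u v`. Closure under multiplication makes `m` associative
(`IsGroupOf.assoc`), and inverses give every element a quasi-inverse, so the algebra `N` is radical
and, being finite-dimensional, nilpotent (`exists_lpow_eq_bot`). The group is abelian exactly when
the product is commutative, and affine conjugacy is exactly isomorphism of algebras
(`IsGroupOf.affConj_of_algIso`, `IsGroupOf.algIso_of_affConj`). The theorem is therefore a
classification of noncommutative nilpotent associative algebras of dimension 4.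

By Nakayama the powers of `N` decrease strictly, so `dim N² ≤ 3`. Noncommutativity excludes `N² =
0`, and also `dim N² = 3`, where one element generates. If `N³ ≠ 0`, then `dim N² = 2`, and
generators can be normalized to one of two tables (`exists_algIso_mulU2`). If `N³ = 0`, the product
is a tuple of `dim N²` independent bilinear forms on `N/N²`, taken up to a change of basis on both
sides. One form on `F³` gives projective congruence and `R_D`.

Two forms on `F²` give a pencil. Alternating forms on `F²` make up a line, so a noncommutative
pencil contains exactly one symmetric form `S` up to scalars, and a second generator matters only
modulo `S`. If `S` has rank one it leads to `U_3`. If it is diagonalizable of rank two, its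
discriminant modulo squares is `ρ` and the similitudes of `x² + ρy²` produce the relation `DivRel`:
this is `U_4`. The remaining `S` is alternating, in characteristic 2, and leads to `U_5` with an
Artin–Schreier class as parameter. The same invariants separate the families and their parameters
(`Label.rel_of_algIso`). -/

namespace NilpAlg

/-! ### Affine maps as matrices acting on row vectors. -/

section Aff

variable {n : ℕ} {F : Type*} [Field F]

/-- The matrix of the affine map `(s, u) ↦ (s, s • a + f u)` acting on row vectors. -/
def aff (a : Fin n → F) (f : (Fin n → F) →ₗ[F] (Fin n → F)) :
    Matrix (Fin (n + 1)) (Fin (n + 1)) F :=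
  Matrix.of (Matrix.vecCons (Matrix.vecCons 1 a)
    fun i => Matrix.vecCons 0 (f (Pi.single i 1)))

theorem vecMul_aff (a : Fin n → F) (f : (Fin n → F) →ₗ[F] (Fin n → F)) (s : F) (u : Fin n → F) :
    Matrix.vecMul (Matrix.vecCons s u) (aff a f) = Matrix.vecCons s (s • a + f u) := by
  have hu : f u = ∑ i, u i • f (Pi.single i 1) := by
    conv_lhs => rw [← LinearMap.sum_single_apply (fun _ => F) u]
    rw [map_sum]
    refine Finset.sum_congr rfl fun i _ => ?_
    rw [← map_smul, ← Pi.single_smul]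
    simp
  ext j
  refine Fin.cases ?_ (fun j => ?_) j
  · simp [Matrix.vecMul, dotProduct, Fin.sum_univ_succ, aff]
  · simp [Matrix.vecMul, dotProduct, Fin.sum_univ_succ, aff, hu]

theorem ext_vecCons {A B : Matrix (Fin (n + 1)) (Fin (n + 1)) F}
    (h : ∀ s u, Matrix.vecMul (Matrix.vecCons s u) A = Matrix.vecMul (Matrix.vecCons s u) B) :
    A = B := by
  ext i j
  have h1 := congrFun (h ((Pi.single i 1 : Fin (n + 1) → F) 0)
    (Fin.tail (Pi.single i 1 : Fin (n + 1) → F))) j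
  have h2 : Matrix.vecCons ((Pi.single i 1 : Fin (n + 1) → F) 0)
      (Fin.tail (Pi.single i 1 : Fin (n + 1) → F)) = Pi.single i 1 :=
    Fin.cons_self_tail _
  rw [h2] at h1
  simpa using h1

/-- Row vectors are acted on from the right, so the left factor is applied first and the linear
parts compose in reversed order. -/
theorem aff_mul (a b : Fin n → F) (f g : (Fin n → F) →ₗ[F] (Fin n → F)) :
    aff a f * aff b g = aff (b + g a) (g ∘ₗ f) := by
  refine ext_vecCons fun s u => ?_
  rw [← Matrix.vecMul_vecMul, vecMul_aff, vecMul_aff, vecMul_aff]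
  simp [smul_add, add_assoc]

theorem aff_one : aff (0 : Fin n → F) LinearMap.id = 1 :=
  ext_vecCons fun s u => by simp [vecMul_aff]

theorem aff_inj {a b : Fin n → F} {f g : (Fin n → F) →ₗ[F] (Fin n → F)}
    (h : aff a f = aff b g) : a = b ∧ f = g := by
  have h1 : ∀ s u, Matrix.vecCons s (s • a + f u) = Matrix.vecCons s (s • b + g u) := by
    intro s u
    rw [← vecMul_aff, ← vecMul_aff, h]
  refine ⟨?_, LinearMap.ext fun u => ?_⟩
  · simpa [Matrix.vecCons_inj] using h1 1 0
  · simpa [Matrix.vecCons_inj] using h1 0 u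

theorem aff_mem_AGL {g : Matrix.GeneralLinearGroup (Fin (n + 1)) F} {a : Fin n → F}
    {f : (Fin n → F) →ₗ[F] (Fin n → F)} (h : g.1 = aff a f) : g ∈ AGL n F := by
  intro i
  rw [h]
  refine Fin.cases ?_ (fun i => ?_) i <;> simp [aff]

theorem exists_aff {g : Matrix.GeneralLinearGroup (Fin (n + 1)) F} (hg : g ∈ AGL n F) :
    g.1 = aff (fun j => g.1 0 j.succ) (Matrix.vecMulLinear (g.1.submatrix Fin.succ Fin.succ)) := by
  have h : ∀ i, g.1 i 0 = if i = 0 then 1 else 0 := hg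
  ext i j
  refine Fin.cases ?_ (fun i => ?_) i <;> refine Fin.cases ?_ (fun j => ?_) j <;>
    simp [aff, h]

/-- The unit given by an affine matrix with invertible linear part. -/
def affUnit (f : (Fin n → F) ≃ₗ[F] (Fin n → F)) : Matrix.GeneralLinearGroup (Fin (n + 1)) F where
  val := aff 0 f
  inv := aff 0 f.symm
  val_inv := by rw [aff_mul, ← aff_one]; simp
  inv_val := by rw [aff_mul, ← aff_one]; simp

end Aff

/-! ### Regular subgroups with linear `δ` as algebras; conjugacy as isomorphism. -/

section Mul

variable {n : ℕ} {F : Type*} [Field F]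

/-- `R` is the set of the affine maps `u ↦ u + v + m u v`. -/
def IsGroupOf (R : Subgroup (Matrix.GeneralLinearGroup (Fin (n + 1)) F))
    (m : (Fin n → F) →ₗ[F] (Fin n → F) →ₗ[F] (Fin n → F)) : Prop :=
  (∀ g ∈ R, ∃ v, g.1 = aff v (LinearMap.id + m.flip v)) ∧
  ∀ v, ∃ g ∈ R, g.1 = aff v (LinearMap.id + m.flip v)

/-- Isomorphism of the (not necessarily associative) algebras given by two bilinear products. -/
def AlgIso {V V' : Type*} [AddCommGroup V] [Module F V] [AddCommGroup V'] [Module F V']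
    (m : V →ₗ[F] V →ₗ[F] V) (m' : V' →ₗ[F] V' →ₗ[F] V') : Prop :=
  ∃ φ : V ≃ₗ[F] V', ∀ u v, φ (m u v) = m' (φ u) (φ v)

section

variable {V V' V'' : Type*} [AddCommGroup V] [Module F V] [AddCommGroup V'] [Module F V']
  [AddCommGroup V''] [Module F V'']
  {m : V →ₗ[F] V →ₗ[F] V} {m' : V' →ₗ[F] V' →ₗ[F] V'} {m'' : V'' →ₗ[F] V'' →ₗ[F] V''}

theorem AlgIso.symm (h : AlgIso m m') : AlgIso m' m := by
  obtain ⟨φ, h⟩ := h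
  refine ⟨φ.symm, fun u v => φ.injective ?_⟩
  simp [h]

theorem AlgIso.trans (h : AlgIso m m') (h' : AlgIso m' m'') : AlgIso m m'' := by
  obtain ⟨φ, h⟩ := h
  obtain ⟨ψ, h'⟩ := h'
  exact ⟨φ.trans ψ, fun u v => by simp [h, h']⟩

end

variable {R S : Subgroup (Matrix.GeneralLinearGroup (Fin (n + 1)) F)}
  {m m' : (Fin n → F) →ₗ[F] (Fin n → F) →ₗ[F] (Fin n → F)}

theorem exists_isGroupOf (hR : R ∈ Delta n F) : ∃ m, IsGroupOf R m := by
  obtain ⟨⟨hA, hr⟩, δ, hδ⟩ := hR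
  let m : (Fin n → F) →ₗ[F] (Fin n → F) →ₗ[F] (Fin n → F) :=
    LinearMap.mk₂ F (fun u v => Matrix.vecMul u (δ v))
      (by intros; simp [Matrix.add_vecMul]) (by intros; simp [Matrix.smul_vecMul])
      (by intros; simp [Matrix.vecMul_add]) (by intros; simp [Matrix.vecMul_smul])
  have key : ∀ g ∈ R, g.1 = aff (fun j => g.1 0 j.succ)
      (LinearMap.id + m.flip (fun j => g.1 0 j.succ)) := by
    intro g hg
    have h1 := exists_aff (hA hg)
    rw [hδ g hg] at h1
    rw [h1]
    congr 1
    refine LinearMap.ext fun u => ?_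
    simp [m, aff]
  refine ⟨m, fun g hg => ⟨_, key g hg⟩, fun v => ?_⟩
  obtain ⟨g, ⟨hg, hv⟩, -⟩ := hr v
  refine ⟨g, hg, ?_⟩
  have h1 : (fun j : Fin n => g.1 0 j.succ) = v := by
    funext j
    rw [hv]
    simp
  simpa [h1] using key g hg

theorem IsGroupOf.mem_delta (h : IsGroupOf R m) : R ∈ Delta n F := by
  obtain ⟨h1, h2⟩ := h
  have row : ∀ (v : Fin n → F) f, aff v f 0 = Matrix.vecCons 1 v := fun v f => rfl
  refine ⟨⟨fun g hg => ?_, fun v => ?_⟩, ?_⟩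
  · obtain ⟨v, hv⟩ := h1 g hg
    exact aff_mem_AGL hv
  · obtain ⟨g, hg, hv⟩ := h2 v
    refine ⟨g, ⟨hg, by rw [hv, row]⟩, ?_⟩
    rintro g' ⟨hg', hv'⟩
    obtain ⟨w, hw⟩ := h1 g' hg'
    rw [hw, row, Matrix.vecCons_inj] at hv'
    refine Units.ext ?_
    rw [hw, hv, hv'.2]
  · refine ⟨{ toFun := fun v => Matrix.of fun i => m (Pi.single i 1) v
              map_add' := fun u v => by ext i j; simp
              map_smul' := fun c v => by ext i j; simp }, fun g hg => ?_⟩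
    obtain ⟨v, hv⟩ := h1 g hg
    rw [hv]
    ext i j
    simp [aff, Matrix.one_apply, Pi.single_apply, eq_comm]

/-- The product of the elements at `v` and `w` lies in `R` and has translation part `v + w + m v w`,
so its linear part is the one attached to that vector. Comparing linear parts at `u` leaves
associativity. -/
theorem IsGroupOf.assoc (h : IsGroupOf R m) (u v w : Fin n → F) :
    m (m u v) w = m u (m v w) := by
  obtain ⟨h1, h2⟩ := h
  obtain ⟨g, hg, hv⟩ := h2 v
  obtain ⟨g', hg', hw⟩ := h2 w
  obtain ⟨z, hz⟩ := h1 _ (R.mul_mem hg hg')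
  rw [Units.val_mul, hv, hw, aff_mul] at hz
  obtain ⟨e1, e2⟩ := aff_inj hz
  have e3 := LinearMap.congr_fun e2 u
  rw [← e1] at e3
  simp only [LinearMap.comp_apply, LinearMap.add_apply, LinearMap.id_apply, LinearMap.flip_apply,
    map_add] at e3
  have e4 : u + m u v + (m u w + m (m u v) w) = u + m u v + (m u w + m u (m v w)) := by
    calc _ = u + m u w + (m u v + m (m u v) w) := by abel
      _ = _ := by rw [e3]; abel
  exact add_left_cancel (add_left_cancel e4)

theorem IsGroupOf.exists_quasiInverse (h : IsGroupOf R m) (a : Fin n → F) :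
    ∃ b, a + b + m a b = 0 := by
  obtain ⟨h1, h2⟩ := h
  obtain ⟨g, hg, hv⟩ := h2 a
  obtain ⟨b, hb⟩ := h1 _ (R.inv_mem hg)
  have e : g.1 * (g⁻¹).1 = aff 0 LinearMap.id := by
    rw [← Units.val_mul, mul_inv_cancel, Units.val_one, aff_one]
  rw [hv, hb, aff_mul] at e
  refine ⟨b, ?_⟩
  rw [← (aff_inj e).1]
  simp only [LinearMap.add_apply, LinearMap.id_apply, LinearMap.flip_apply]
  abel

theorem IsGroupOf.isNonabelian_iff (h : IsGroupOf R m) :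
    IsNonabelian R ↔ ∃ u v, m u v ≠ m v u := by
  obtain ⟨h1, h2⟩ := id h
  constructor
  · rintro ⟨a, ha, b, hb, hab⟩
    obtain ⟨v, hv⟩ := h1 a ha
    obtain ⟨w, hw⟩ := h1 b hb
    by_contra! hc
    refine hab (Units.ext ?_)
    rw [Units.val_mul, Units.val_mul, hv, hw, aff_mul, aff_mul]
    congr 1
    · simp [hc v w, add_left_comm]
    · refine LinearMap.ext fun u => ?_
      simp only [LinearMap.comp_apply, LinearMap.add_apply, LinearMap.id_apply,
        LinearMap.flip_apply, map_add, h.assoc, hc v w]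
      abel
  · rintro ⟨u, v, huv⟩
    obtain ⟨a, ha, hu⟩ := h2 u
    obtain ⟨b, hb, hv⟩ := h2 v
    refine ⟨a, ha, b, hb, fun hc => huv ?_⟩
    have e := congrArg Units.val hc
    rw [Units.val_mul, Units.val_mul, hu, hv, aff_mul, aff_mul] at e
    have e1 := (aff_inj e).1
    simp only [LinearMap.add_apply, LinearMap.id_apply, LinearMap.flip_apply] at e1
    have e2 : u + v + m u v = u + v + m v u := by
      calc u + v + m u v = v + (u + m u v) := by abel
        _ = _ := by rw [e1]; abel
    exact add_left_cancel e2

theorem IsGroupOf.affConj_of_algIso (hR : IsGroupOf R m) (hS : IsGroupOf S m')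
    (h : AlgIso m m') : AffConj R S := by
  obtain ⟨φ, hφ⟩ := h
  -- Because of the right action, conjugating by the matrix of `φ.symm` carries the map `r` to `φ ∘
  -- r ∘ φ⁻¹`.
  refine ⟨affUnit φ.symm, aff_mem_AGL (a := 0) (f := φ.symm) rfl, ?_⟩
  have key : ∀ (r : Matrix.GeneralLinearGroup (Fin (n + 1)) F) v,
      r.1 = aff v (LinearMap.id + m.flip v) →
      (affUnit φ.symm * r * (affUnit φ.symm)⁻¹).1 = aff (φ v) (LinearMap.id + m'.flip (φ v)) := by
    intro r v hv
    have : (affUnit φ.symm * r * (affUnit φ.symm)⁻¹).1 =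
      aff 0 (φ.symm : (Fin n → F) →ₗ[F] (Fin n → F)) * r.1 * aff 0 φ := rfl
    rw [this, hv, aff_mul, aff_mul]
    congr 1
    · simp
    · refine LinearMap.ext fun u => ?_
      simp [hφ]
  ext s
  rw [Subgroup.mem_map]
  constructor
  · intro hs
    obtain ⟨w, hw⟩ := hS.1 s hs
    obtain ⟨r, hr, hv⟩ := hR.2 (φ.symm w)
    refine ⟨r, hr, Units.ext ?_⟩
    have := key r _ hv
    rw [φ.apply_symm_apply] at this
    exact this.trans hw.symm
  · rintro ⟨r, hr, rfl⟩
    obtain ⟨v, hv⟩ := hR.1 r hr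
    obtain ⟨s, hs, hw⟩ := hS.2 (φ v)
    have : (MulAut.conj (affUnit φ.symm)).toMonoidHom r = s :=
      Units.ext ((key r v hv).trans hw.symm)
    rw [this]
    exact hs

/-- The linear part `φ` of the conjugating element need not be multiplicative because of its
translation part `a`. The correction is `T = 1 + L_a`, with `L_a` left multiplication by `a`:
associativity gives `T (x y) = (T x) y`, and `T⁻¹ ∘ φ` is an isomorphism. -/
theorem IsGroupOf.algIso_of_affConj (hR : IsGroupOf R m) (hS : IsGroupOf S m')
    (h : AffConj R S) : AlgIso m' m := by
  obtain ⟨g, hg, rfl⟩ := h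
  have hga := exists_aff hg
  have hgb := exists_aff ((AGL n F).inv_mem hg)
  set a := fun j : Fin n => g.1 0 j.succ
  set f := Matrix.vecMulLinear (g.1.submatrix Fin.succ Fin.succ)
  set b := fun j : Fin n => (g⁻¹).1 0 j.succ
  set f' := Matrix.vecMulLinear ((g⁻¹).1.submatrix Fin.succ Fin.succ)
  have hff : f ∘ₗ f' = LinearMap.id := by
    have e : (g⁻¹).1 * g.1 = aff 0 LinearMap.id := by
      rw [← Units.val_mul, inv_mul_cancel, Units.val_one, aff_one]
    rw [hga, hgb, aff_mul] at e
    exact (aff_inj e).2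
  have hff' : f' ∘ₗ f = LinearMap.id := by
    have e : g.1 * (g⁻¹).1 = aff 0 LinearMap.id := by
      rw [← Units.val_mul, mul_inv_cancel, Units.val_one, aff_one]
    rw [hga, hgb, aff_mul] at e
    exact (aff_inj e).2
  let φ : (Fin n → F) ≃ₗ[F] (Fin n → F) := LinearEquiv.ofLinearMap f f' hff hff'
  -- Here `w` and `v` are the vectors of `g r g⁻¹` and of `r`; the two equations are the translation
  -- and linear parts of `(g r g⁻¹) g = g r`.
  have key : ∀ w, ∃ v, φ w = v + m a v ∧ ∀ u, φ (m' u w) = m (φ u) v := by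
    intro w
    obtain ⟨s, hs, hw⟩ := hS.2 w
    obtain ⟨r, hr, rfl⟩ := Subgroup.mem_map.1 hs
    obtain ⟨v, hv⟩ := hR.1 r hr
    have e : ((MulAut.conj g).toMonoidHom r).1 * g.1 = g.1 * r.1 := by
      rw [← Units.val_mul, ← Units.val_mul]
      simp
    rw [hw, hga, hv, aff_mul, aff_mul] at e
    obtain ⟨e1, e2⟩ := aff_inj e
    refine ⟨v, ?_, fun u => ?_⟩
    · have e3 : a + f w = a + (v + m a v) := by
        rw [e1]
        simp only [LinearMap.add_apply, LinearMap.id_apply, LinearMap.flip_apply]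
        abel
      exact add_left_cancel e3
    · have e3 := LinearMap.congr_fun e2 u
      simp only [LinearMap.comp_apply, LinearMap.add_apply, LinearMap.id_apply,
        LinearMap.flip_apply, map_add] at e3
      exact add_left_cancel e3
  let T : (Fin n → F) →ₗ[F] (Fin n → F) := LinearMap.id + m a
  have hT : Function.Surjective T := by
    intro y
    obtain ⟨v, hv, -⟩ := key (φ.symm y)
    exact ⟨v, by simpa [T] using hv.symm⟩
  let T' := LinearEquiv.ofBijective T ⟨LinearMap.injective_iff_surjective.2 hT, hT⟩
  have hT' : ∀ x, T' x = x + m a x := fun x => rfl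
  have hTm : ∀ x y, T' (m x y) = m (T' x) y := by
    intro x y
    simp [hT', hR.assoc]
  refine ⟨φ.trans T'.symm, fun u w => T'.injective ?_⟩
  obtain ⟨v, hv, hu⟩ := key w
  have hv' : T'.symm (φ w) = v := by
    rw [LinearEquiv.symm_apply_eq, hT', hv]
  simp only [LinearEquiv.trans_apply, hTm, LinearEquiv.apply_symm_apply, hv', hu]

end Mul

/-! ### Radical algebras: Nakayama, nilpotency and generation modulo the square. -/

section Radical

variable {F V : Type*} [Field F] [AddCommGroup V] [Module F V]
  {m : V →ₗ[F] V →ₗ[F] V}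

/-- The powers of an algebra (with a shift by one of the exponent). -/
def lpow (m : V →ₗ[F] V →ₗ[F] V) : ℕ → Submodule F V
  | 0 => ⊤
  | k + 1 => Submodule.map₂ m (lpow m k) ⊤

theorem lpow_right_mem (k : ℕ) : ∀ w ∈ lpow m k, ∀ a, m w a ∈ lpow m k := by
  induction k with
  | zero => exact fun _ _ _ => trivial
  | succ k ih =>
    intro w hw a
    have h : lpow m (k + 1) ≤ lpow m k := Submodule.map₂_le.2 fun w hw a _ => ih w hw a
    exact Submodule.apply_mem_map₂ m (h hw) trivial

/-- The powers are built by multiplying on the right only; associativity moves a left factor inside,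
so they behave as two-sided ideals. -/
theorem left_mul_mem_lpow (assoc : ∀ u v w, m (m u v) w = m u (m v w)) (k : ℕ) (a : V) :
    ∀ w ∈ lpow m k, m a w ∈ lpow m (k + 1) := by
  induction k with
  | zero => exact fun w _ => Submodule.apply_mem_map₂ m trivial trivial
  | succ k ih =>
    have h : lpow m (k + 1) ≤ (lpow m (k + 2)).comap (m a) := by
      refine Submodule.map₂_le.2 fun u hu v _ => ?_
      rw [Submodule.mem_comap, ← assoc]
      exact Submodule.apply_mem_map₂ m (ih u hu) trivial
    exact fun w hw => h hw

variable [FiniteDimensional F V]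

/-- Nakayama's lemma for radical algebras. -/
theorem map₂_lt_of_quasiInverse (assoc : ∀ u v w, m (m u v) w = m u (m v w))
    (hq : ∀ a, ∃ b, a + b + m a b = 0) {W : Submodule F V} (hW : W ≠ ⊥)
    (hWr : ∀ w ∈ W, ∀ a, m w a ∈ W) : Submodule.map₂ m W ⊤ < W := by
  have hle : Submodule.map₂ m W ⊤ ≤ W := Submodule.map₂_le.2 fun w hw a _ => hWr w hw a
  refine lt_of_le_of_ne hle fun heq => ?_
  let s : Set (Submodule F V) := {U | U < W ∧ ∀ w ∈ U, ∀ a, m w a ∈ U}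
  have hs : s.Nonempty := ⟨⊥, bot_lt_iff_ne_bot.2 hW, fun w hw a => by
    rw [(Submodule.mem_bot F).1 hw]; simp⟩
  -- `U` is a maximal proper right submodule of `W`. Since `W N = W`, some `w ∈ W` satisfies `w N ⊄
  -- U`, and maximality gives `U + w N = W`.
  obtain ⟨U, ⟨hUW, hUr⟩, hmax⟩ := WellFounded.has_min
    (wellFounded_gt : WellFounded ((· > ·) : Submodule F V → Submodule F V → Prop)) s hs
  have hnotin : ∃ w ∈ W, ∃ a, m w a ∉ U := by
    by_contra! h
    exact (hUW.trans_le heq.ge).not_ge (Submodule.map₂_le.2 fun w hw a _ => h w hw a)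
  obtain ⟨w, hw, a, hwa⟩ := hnotin
  have hX : U ⊔ Submodule.map (m w) ⊤ = W := by
    by_contra hne
    have hle : U ⊔ Submodule.map (m w) ⊤ ≤ W := by
      refine sup_le hUW.le ?_
      rintro _ ⟨x, -, rfl⟩
      exact hWr w hw x
    refine hmax _ ⟨lt_of_le_of_ne hle hne, ?_⟩ ?_
    · intro y hy c
      obtain ⟨y1, h1, _, ⟨x, -, rfl⟩, rfl⟩ := Submodule.mem_sup.1 hy
      rw [map_add, LinearMap.add_apply, assoc]
      exact Submodule.add_mem_sup (hUr _ h1 _) ⟨_, trivial, rfl⟩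
    · refine lt_of_le_of_ne le_sup_left fun h => hwa ?_
      rw [h]
      exact Submodule.mem_sup_right ⟨a, trivial, rfl⟩
  rw [← hX] at hw
  obtain ⟨y, hy, _, ⟨x, -, rfl⟩, hyx⟩ := Submodule.mem_sup.1 hw
  -- Now `w = y + w x` with `y ∈ U`, formally `w (1 - x) = y`. The quasi-inverse `b` of `-x` inverts
  -- `1 - x`, so `w = y + y b ∈ U`, a contradiction.
  obtain ⟨b, hb⟩ := hq (-x)
  have hwU : y + m y b = w := by
    have h1 : y = w - m w x := eq_sub_of_add_eq hyx
    have h2 : m w (-x + b + m (-x) b) = 0 := by rw [hb, map_zero]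
    rw [map_add, map_add, ← assoc] at h2
    rw [h1]
    calc _ = w + (m w (-x) + m w b + m (m w (-x)) b) := by
          simp only [map_sub, map_neg, LinearMap.sub_apply, LinearMap.neg_apply]
          abel
      _ = w := by rw [h2, add_zero]
  refine hwa (hUr w ?_ a)
  rw [← hwU]
  exact U.add_mem hy (hUr _ hy _)

theorem lpow_succ_lt (assoc : ∀ u v w, m (m u v) w = m u (m v w))
    (hq : ∀ a, ∃ b, a + b + m a b = 0) {k : ℕ} (hk : lpow m k ≠ ⊥) :
    lpow m (k + 1) < lpow m k :=
  map₂_lt_of_quasiInverse assoc hq hk (lpow_right_mem k)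

theorem exists_lpow_eq_bot (assoc : ∀ u v w, m (m u v) w = m u (m v w))
    (hq : ∀ a, ∃ b, a + b + m a b = 0) : ∃ k, lpow m k = ⊥ := by
  by_contra! h
  have key : ∀ k, Module.finrank F (lpow m k) + k ≤ Module.finrank F V := by
    intro k
    induction k with
    | zero => exact Submodule.finrank_le _
    | succ k ih =>
      have := Submodule.finrank_lt_finrank_of_lt (lpow_succ_lt assoc hq (h k))
      omega
  have := key (Module.finrank F V + 1)
  omega

/-- A subalgebra that generates modulo the square is everything. -/
theorem eq_top_of_sup_lpow_one (assoc : ∀ u v w, m (m u v) w = m u (m v w))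
    (hq : ∀ a, ∃ b, a + b + m a b = 0) {K : Submodule F V}
    (hK : ∀ u ∈ K, ∀ v ∈ K, m u v ∈ K) (h : K ⊔ lpow m 1 = ⊤) : K = ⊤ := by
  have key : ∀ k, K ⊔ lpow m (k + 1) = ⊤ := by
    intro k
    induction k with
    | zero => exact h
    | succ k ih =>
      rw [eq_top_iff, ← h]
      refine sup_le le_sup_left (Submodule.map₂_le.2 fun u _ v _ => ?_)
      -- Write both factors as an element of `K` plus one of the current power: the product of the
      -- `K`-parts stays in `K`, and every other term falls into the next power.
      obtain ⟨a, ha, j, hj, rfl⟩ := Submodule.mem_sup.1 (ih.ge (Submodule.mem_top (x := u)))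
      obtain ⟨b, hb, j', hj', rfl⟩ := Submodule.mem_sup.1 (ih.ge (Submodule.mem_top (x := v)))
      rw [map_add, map_add, LinearMap.add_apply, LinearMap.add_apply]
      refine Submodule.add_mem _ (Submodule.add_mem _ ?_ ?_) (Submodule.add_mem _ ?_ ?_)
      · exact Submodule.mem_sup_left (hK _ ha _ hb)
      · exact Submodule.mem_sup_right (Submodule.apply_mem_map₂ m hj trivial)
      · exact Submodule.mem_sup_right (left_mul_mem_lpow assoc _ _ _ hj')
      · exact Submodule.mem_sup_right (left_mul_mem_lpow assoc _ _ _ hj')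
  obtain ⟨k, hk⟩ := exists_lpow_eq_bot assoc hq
  have h0 : lpow m (k + 1) = ⊥ := by rw [lpow, hk, Submodule.map₂_bot_left]
  simpa [h0] using key k

/-- The centralizer of an element is a subalgebra, hence everything once it contains generators
modulo the square. This is applied first to a generator and then to an arbitrary element. -/
theorem comm_of_span_sup (assoc : ∀ u v w, m (m u v) w = m u (m v w))
    (hq : ∀ a, ∃ b, a + b + m a b = 0) {s : Set V} (hs : ∀ x ∈ s, ∀ y ∈ s, m x y = m y x)
    (h : Submodule.span F s ⊔ lpow m 1 = ⊤) (u v : V) : m u v = m v u := by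
  have key : ∀ y, (∀ x ∈ s, m x y = m y x) → ∀ z, m z y = m y z := by
    intro y hxy
    let K : Submodule F V := LinearMap.ker (m.flip y - m y)
    have hmem : ∀ z, z ∈ K ↔ m z y = m y z := by
      intro z
      rw [LinearMap.mem_ker, LinearMap.sub_apply, sub_eq_zero, LinearMap.flip_apply]
    have hK : K = ⊤ := by
      refine eq_top_of_sup_lpow_one assoc hq ?_ ?_
      · intro u hu v hv
        rw [hmem] at hu hv ⊢
        rw [assoc, hv, ← assoc, hu, assoc]
      · rw [eq_top_iff, ← h]
        exact sup_le_sup_right (Submodule.span_le.2 fun x hx => (hmem x).2 (hxy x hx)) _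
    intro z
    rw [← hmem, hK]
    trivial
  exact key v (fun x hx => (key x (fun y hy => hs y hy x hx) v).symm) u

/-- A square of codimension one means that a single element generates the algebra. -/
theorem comm_of_finrank_lpow_one (assoc : ∀ u v w, m (m u v) w = m u (m v w))
    (hq : ∀ a, ∃ b, a + b + m a b = 0)
    (h : Module.finrank F (lpow m 1) + 1 = Module.finrank F V) (u v : V) : m u v = m v u := by
  have hlt : lpow m 1 < ⊤ := by
    refine lt_top_iff_ne_top.2 fun h1 => ?_
    rw [h1, finrank_top] at h
    omega
  obtain ⟨x, -, hx⟩ := SetLike.exists_of_lt hlt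
  refine comm_of_span_sup assoc hq (s := {x}) (by simp) (Submodule.eq_top_of_finrank_eq ?_) u v
  have h1 : lpow m 1 < Submodule.span F {x} ⊔ lpow m 1 :=
    lt_of_le_of_ne le_sup_right fun he => hx <| by
      rw [he]; exact Submodule.mem_sup_left (Submodule.mem_span_singleton_self x)
  have h2 := Submodule.finrank_lt_finrank_of_lt h1
  have h3 := Submodule.finrank_le (Submodule.span F {x} ⊔ lpow m 1)
  omega

end Radical

/-! ### Algebras with vanishing triple products as tuples of bilinear forms. -/

section SquareZero

variable {F : Type*} [Field F] {n k : ℕ}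

/-- The algebra on `F^n × F^k` with product `(u, s) (v, t) = (0, (u Mᵢ vᵀ)ᵢ)`. -/
def zmul (M : Fin k → Matrix (Fin n) (Fin n) F) :
    ((Fin n → F) × (Fin k → F)) →ₗ[F] ((Fin n → F) × (Fin k → F)) →ₗ[F]
      ((Fin n → F) × (Fin k → F)) :=
  LinearMap.mk₂ F (fun p q => (0, fun i => p.1 ⬝ᵥ (M i).mulVec q.1))
    (by intros; ext <;> simp [add_dotProduct]) (by intros; ext <;> simp [smul_dotProduct])
    (by intros; ext <;> simp [Matrix.mulVec_add, dotProduct_add])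
    (by intros; ext <;> simp [Matrix.mulVec_smul, dotProduct_smul])

theorem zmul_apply (M : Fin k → Matrix (Fin n) (Fin n) F) (p q : (Fin n → F) × (Fin k → F)) :
    zmul M p q = (0, fun i => p.1 ⬝ᵥ (M i).mulVec q.1) := rfl

/-- The isomorphism is `(u, s) ↦ (u P, Q s)`. -/
theorem zmul_algIso {M M' : Fin k → Matrix (Fin n) (Fin n) F} {P : Matrix (Fin n) (Fin n) F}
    {Q : Matrix (Fin k) (Fin k) F} (hP : P.det ≠ 0) (hQ : Q.det ≠ 0)
    (h : ∀ i, P * M' i * P.transpose = ∑ j, Q i j • M j) : AlgIso (zmul M) (zmul M') := by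
  have hP' : Function.Injective (Matrix.vecMulLinear P) :=
    Matrix.vecMul_injective_of_isUnit ((Matrix.isUnit_iff_isUnit_det P).2 hP.isUnit)
  have hQ' : Function.Injective (Matrix.mulVecLin Q) :=
    Matrix.mulVec_injective_of_isUnit ((Matrix.isUnit_iff_isUnit_det Q).2 hQ.isUnit)
  refine ⟨(LinearEquiv.ofInjectiveEndo _ hP').prodCongr (LinearEquiv.ofInjectiveEndo _ hQ'),
    fun p q => ?_⟩
  refine Prod.ext ?_ (funext fun i => ?_)
  · simp [zmul_apply]
  · have h1 : Matrix.vecMul p.1 P ⬝ᵥ (M' i).mulVec (Matrix.vecMul q.1 P) =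
        p.1 ⬝ᵥ (P * M' i * P.transpose).mulVec q.1 := by
      rw [← Matrix.mulVec_transpose P q.1, ← Matrix.dotProduct_mulVec, Matrix.mulVec_mulVec,
        Matrix.mulVec_mulVec, Matrix.mul_assoc]
    simp only [zmul_apply, LinearEquiv.prodCongr_apply, LinearEquiv.coe_ofInjectiveEndo,
      Matrix.vecMulLinear_apply, Matrix.mulVecLin_apply]
    rw [h1, h i, Matrix.sum_mulVec, dotProduct_sum]
    rw [Matrix.mulVec, dotProduct]
    exact Finset.sum_congr rfl fun j _ => by rw [Matrix.smul_mulVec, dotProduct_smul, smul_eq_mul]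

/-- A nonzero functional killing all products would be a linear relation among the forms `M i`. -/
theorem span_zmul_eq_top {M : Fin k → Matrix (Fin n) (Fin n) F} (hM : LinearIndependent F M) :
    Submodule.span F {z : Fin k → F | ∃ u v, z = fun i => u ⬝ᵥ (M i).mulVec v} = ⊤ := by
  by_contra hne
  obtain ⟨f, hf, hle⟩ := Submodule.exists_le_ker_of_lt_top _ (lt_top_iff_ne_top.2 hne)
  refine hf ?_
  have hfz : ∀ z, f z = ∑ i, f (Pi.single i 1) * z i := by
    intro z
    conv_lhs => rw [← LinearMap.sum_single_apply (fun _ => F) z]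
    rw [map_sum]
    refine Finset.sum_congr rfl fun i _ => ?_
    have h : LinearMap.single F (fun _ => F) i (z i) = z i • Pi.single i 1 := by
      rw [← Pi.single_smul]; simp
    exact (congrArg f h).trans (by rw [map_smul, smul_eq_mul, mul_comm])
  have h0 : ∑ i, f (Pi.single i 1) • M i = 0 := by
    ext a b
    have h1 := hle (Submodule.subset_span ⟨Pi.single a 1, Pi.single b 1, rfl⟩)
    rw [LinearMap.mem_ker, hfz] at h1
    simpa [Matrix.sum_apply] using h1
  have h1 := Fintype.linearIndependent_iff.1 hM _ h0
  refine LinearMap.ext fun z => ?_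
  rw [hfz]
  simp [h1]

/-- Independence makes `0 × F^k` the span of the products, so an isomorphism maps it into `0 × F^k`.
It is then block triangular, and its diagonal blocks give `P` and `Q`. -/
theorem exists_of_zmul_algIso {M M' : Fin k → Matrix (Fin n) (Fin n) F}
    (hM : LinearIndependent F M) (h : AlgIso (zmul M) (zmul M')) :
    ∃ (P : Matrix (Fin n) (Fin n) F) (Q : Matrix (Fin k) (Fin k) F), P.det ≠ 0 ∧ Q.det ≠ 0 ∧
      ∀ i, P * M' i * P.transpose = ∑ j, Q i j • M j := by
  obtain ⟨φ, hφ⟩ := h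
  let p : (Fin n → F) →ₗ[F] (Fin n → F) :=
    LinearMap.fst F _ _ ∘ₗ φ.toLinearMap ∘ₗ LinearMap.inl F (Fin n → F) (Fin k → F)
  let q : (Fin k → F) →ₗ[F] (Fin k → F) :=
    LinearMap.snd F _ _ ∘ₗ φ.toLinearMap ∘ₗ LinearMap.inr F (Fin n → F) (Fin k → F)
  have hq : ∀ z : Fin k → F, φ (0, z) = (0, q z) := by
    have h1 : ∀ z : Fin k → F, (φ (0, z)).1 = 0 := by
      intro z
      have hz : z ∈ Submodule.span F {z : Fin k → F | ∃ u v, z = fun i => u ⬝ᵥ (M i).mulVec v} := by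
        rw [span_zmul_eq_top hM]; trivial
      have hle : Submodule.span F {z : Fin k → F | ∃ u v, z = fun i => u ⬝ᵥ (M i).mulVec v} ≤
          LinearMap.ker (LinearMap.fst F _ _ ∘ₗ φ.toLinearMap ∘ₗ
            LinearMap.inr F (Fin n → F) (Fin k → F)) := by
        rw [Submodule.span_le]
        rintro _ ⟨u, v, rfl⟩
        have := hφ (u, 0) (v, 0)
        rw [zmul_apply, zmul_apply] at this
        simp [this]
      exact hle hz
    intro z
    exact Prod.ext (h1 z) rfl
  have hqi : Function.Injective q := by
    rw [injective_iff_map_eq_zero]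
    intro z hz
    have h1 := hq z
    rw [hz] at h1
    have h2 : ((0, z) : (Fin n → F) × (Fin k → F)) = 0 := φ.map_eq_zero_iff.1 h1
    exact (Prod.ext_iff.1 h2).2
  have hps : Function.Surjective p := by
    intro y
    obtain ⟨x, hx⟩ := φ.surjective (y, 0)
    refine ⟨x.1, ?_⟩
    have h1 : φ x = φ (x.1, 0) + φ (0, x.2) := by rw [← map_add]; simp
    rw [hx, hq] at h1
    have := (Prod.ext_iff.1 h1).1
    simpa [p] using this.symm
  have hpi := LinearMap.injective_iff_surjective.2 hps
  have hmain : ∀ u v i, p u ⬝ᵥ (M' i).mulVec (p v) = q (fun i => u ⬝ᵥ (M i).mulVec v) i := by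
    intro u v i
    have h1 := hφ (u, 0) (v, 0)
    rw [zmul_apply, zmul_apply, hq] at h1
    exact (congrFun (Prod.ext_iff.1 h1).2 i).symm
  have hdet : ∀ {l : ℕ} (f : (Fin l → F) →ₗ[F] (Fin l → F)), Function.Injective f →
      (LinearMap.toMatrix' f).det ≠ 0 := by
    intro l f hf
    rw [LinearMap.det_toMatrix']
    exact (LinearEquiv.isUnit_det' (LinearEquiv.ofInjectiveEndo f hf)).ne_zero
  refine ⟨(LinearMap.toMatrix' p).transpose, LinearMap.toMatrix' q, ?_, hdet q hqi, fun i => ?_⟩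
  · rw [Matrix.det_transpose]; exact hdet p hpi
  · ext a b
    have h1 := hmain (Pi.single a 1) (Pi.single b 1) i
    rw [← LinearMap.toMatrix'_mulVec q] at h1
    have h2 : ∀ a, p (Pi.single a 1) = (LinearMap.toMatrix' p).transpose a := by
      intro a
      funext j
      simp [LinearMap.toMatrix'_apply]
    have h3 : ((LinearMap.toMatrix' p).transpose * M' i * (LinearMap.toMatrix' p)) a b =
        p (Pi.single a 1) ⬝ᵥ (M' i).mulVec (p (Pi.single b 1)) := by
      rw [h2, h2, Matrix.dotProduct_mulVec]
      rfl
    rw [Matrix.transpose_transpose, h3, h1, Matrix.sum_apply]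
    simp [Matrix.mulVec, dotProduct, Pi.single_apply]

/-- The square annihilates everything, so the product is determined on a complement `W` of it; the
forms are its coordinates. They are independent because the products span the square. -/
theorem exists_algIso_zmul {V : Type*} [AddCommGroup V] [Module F V] [FiniteDimensional F V]
    {m : V →ₗ[F] V →ₗ[F] V} (assoc : ∀ u v w, m (m u v) w = m u (m v w))
    (h3 : ∀ u v w, m (m u v) w = 0) (hV : Module.finrank F V = n + k)
    (hk : Module.finrank F (lpow m 1) = k) :
    ∃ M : Fin k → Matrix (Fin n) (Fin n) F, LinearIndependent F M ∧ AlgIso m (zmul M) := by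
  set D := lpow m 1 with hD
  have hmem : ∀ u v, m u v ∈ D := fun u v => Submodule.apply_mem_map₂ m trivial trivial
  have hDl : ∀ d ∈ D, ∀ v, m d v = 0 := by
    intro d hd v
    have hle : D ≤ LinearMap.ker (m.flip v) := Submodule.map₂_le.2 fun a _ b _ => h3 a b v
    exact hle hd
  have hDr : ∀ d ∈ D, ∀ v, m v d = 0 := by
    intro d hd v
    have hle : D ≤ LinearMap.ker (m v) := Submodule.map₂_le.2 fun a _ b _ => by
      rw [LinearMap.mem_ker, ← assoc, h3]
    exact hle hd
  obtain ⟨W, hW⟩ := Submodule.exists_isCompl D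
  have hfW : Module.finrank F W = n := by
    have := Submodule.finrank_add_eq_of_isCompl hW
    omega
  let e1 : W ≃ₗ[F] (Fin n → F) := LinearEquiv.ofFinrankEq _ _ (by simpa using hfW)
  let e2 : D ≃ₗ[F] (Fin k → F) := LinearEquiv.ofFinrankEq _ _ (by simpa using hk)
  let B : (Fin n → F) →ₗ[F] (Fin n → F) →ₗ[F] (Fin k → F) :=
    LinearMap.mk₂ F (fun u v => e2 ⟨m (e1.symm u) (e1.symm v), hmem _ _⟩)
      (by intros; rw [← map_add]; congr 1; ext; simp)
      (by intros; rw [← map_smul]; congr 1; ext; simp)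
      (by intros; rw [← map_add]; congr 1; ext; simp)
      (by intros; rw [← map_smul]; congr 1; ext; simp)
  let M : Fin k → Matrix (Fin n) (Fin n) F := fun i =>
    LinearMap.toMatrix₂' F (B.compr₂ (LinearMap.proj i))
  have hB : ∀ u v i, u ⬝ᵥ (M i).mulVec v = B u v i := by
    intro u v i
    rw [← Matrix.toLinearMap₂'_apply']
    simp [M]
  refine ⟨M, ?_, ?_⟩
  · rw [Fintype.linearIndependent_iff]
    intro c hc i
    let g : D →ₗ[F] F := (∑ i, c i • LinearMap.proj i) ∘ₗ (e2 : D →ₗ[F] (Fin k → F))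
    have hg : ∀ z, g z = ∑ i, c i * e2 z i := by
      intro z
      simp [g]
    have hgB : ∀ u v, g ⟨m (e1.symm u) (e1.symm v), hmem _ _⟩ = 0 := by
      intro u v
      rw [hg]
      calc _ = ∑ i, c i * (u ⬝ᵥ (M i).mulVec v) :=
            Finset.sum_congr rfl fun i _ => by rw [hB]; rfl
        _ = u ⬝ᵥ (∑ i, c i • M i).mulVec v := by
            rw [Matrix.sum_mulVec, dotProduct_sum]
            simp [Matrix.smul_mulVec]
        _ = 0 := by rw [hc]; simp
    have hle : D ≤ (LinearMap.ker g).map D.subtype := by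
      refine Submodule.map₂_le.2 fun u _ v _ => ⟨⟨m u v, hmem u v⟩, ?_, rfl⟩
      obtain ⟨d, hd, w, hw, rfl⟩ := Submodule.mem_sup.1 (hW.sup_eq_top.ge (Submodule.mem_top (x := u)))
      obtain ⟨d', hd', w', hw', rfl⟩ :=
        Submodule.mem_sup.1 (hW.sup_eq_top.ge (Submodule.mem_top (x := v)))
      have h1 := hgB (e1 ⟨w, hw⟩) (e1 ⟨w', hw'⟩)
      simpa [hDl d hd, hDr d' hd'] using h1
    obtain ⟨z, hz, hz'⟩ := hle (e2.symm (Pi.single i 1)).2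
    have : z = e2.symm (Pi.single i 1) := Subtype.ext hz'
    rw [this] at hz
    have h1 := hg (e2.symm (Pi.single i 1))
    rw [LinearMap.mem_ker.1 hz] at h1
    simpa [Pi.single_apply] using h1.symm
  · obtain ⟨E, hE⟩ : ∃ E : (W × D) ≃ₗ[F] V, ∀ x, E x = x.1 + x.2 :=
      ⟨Submodule.prodEquivOfIsCompl W D hW.symm, fun x => by simp⟩
    refine ⟨E.symm.trans (e1.prodCongr e2), fun u v => ?_⟩
    obtain ⟨⟨w, d⟩, rfl⟩ := E.surjective u
    obtain ⟨⟨w', d'⟩, rfl⟩ := E.surjective v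
    have h1 : m (E (w, d)) (E (w', d')) = E (0, ⟨m w w', hmem _ _⟩) := by
      simp [hE, hDl d d.2, hDr d' d'.2]
    rw [h1]
    refine Prod.ext ?_ (funext fun i => ?_)
    · simp [zmul_apply]
    · simp [zmul_apply, hB, B]

end SquareZero

/-! ### The algebras of the subgroups in the table. -/

section Models

variable {F : Type*} [Field F]

/-- `R` is the regular subgroup of an algebra isomorphic to the one with product `m'`. -/
def HasAlgebra {n : ℕ} {V : Type*} [AddCommGroup V] [Module F V]
    (R : Subgroup (Matrix.GeneralLinearGroup (Fin (n + 1)) F)) (m' : V →ₗ[F] V →ₗ[F] V) : Prop :=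
  ∃ m, IsGroupOf R m ∧ AlgIso m m'

theorem HasAlgebra.algIso {n : ℕ} {V V' : Type*} [AddCommGroup V] [Module F V]
    [AddCommGroup V'] [Module F V'] {R S : Subgroup (Matrix.GeneralLinearGroup (Fin (n + 1)) F)}
    {m : V →ₗ[F] V →ₗ[F] V} {m' : V' →ₗ[F] V' →ₗ[F] V'} (hR : HasAlgebra R m)
    (hS : HasAlgebra S m') (h : AffConj R S) : AlgIso m m' := by
  obtain ⟨m₁, h1, h1'⟩ := hR
  obtain ⟨m₂, h2, h2'⟩ := hS
  exact (h1'.symm.trans (h1.algIso_of_affConj h2 h).symm).trans h2'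

theorem HasAlgebra.mem_delta {n : ℕ} {V : Type*} [AddCommGroup V] [Module F V]
    {R : Subgroup (Matrix.GeneralLinearGroup (Fin (n + 1)) F)}
    {m : V →ₗ[F] V →ₗ[F] V} (hR : HasAlgebra R m) : R ∈ Delta n F := by
  obtain ⟨m₁, h1, -⟩ := hR
  exact h1.mem_delta

theorem HasAlgebra.isNonabelian_iff {n : ℕ} {V : Type*} [AddCommGroup V] [Module F V]
    {R : Subgroup (Matrix.GeneralLinearGroup (Fin (n + 1)) F)}
    {m : V →ₗ[F] V →ₗ[F] V} (hR : HasAlgebra R m) : IsNonabelian R ↔ ∃ u v, m u v ≠ m v u := by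
  obtain ⟨m₁, h1, φ, hφ⟩ := hR
  rw [h1.isNonabelian_iff]
  constructor
  · rintro ⟨u, v, h⟩
    refine ⟨φ u, φ v, fun he => h ?_⟩
    rw [← hφ, ← hφ] at he
    exact φ.injective he
  · rintro ⟨u, v, h⟩
    refine ⟨φ.symm u, φ.symm v, fun he => h ?_⟩
    have h1 := hφ (φ.symm u) (φ.symm v)
    rw [he, hφ] at h1
    simpa using h1.symm

/-- Transport of a product along a linear equivalence. -/
def transport {V V' : Type*} [AddCommGroup V] [Module F V] [AddCommGroup V'] [Module F V']
    (e : V ≃ₗ[F] V') (m : V' →ₗ[F] V' →ₗ[F] V') : V →ₗ[F] V →ₗ[F] V :=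
  (m.compl₁₂ e.toLinearMap e.toLinearMap).compr₂ e.symm.toLinearMap

theorem transport_apply {V V' : Type*} [AddCommGroup V] [Module F V] [AddCommGroup V']
    [Module F V'] (e : V ≃ₗ[F] V') (m : V' →ₗ[F] V' →ₗ[F] V') (u v : V) :
    transport e m u v = e.symm (m (e u) (e v)) := rfl

theorem transport_algIso {V V' : Type*} [AddCommGroup V] [Module F V] [AddCommGroup V']
    [Module F V'] (e : V ≃ₗ[F] V') (m : V' →ₗ[F] V' →ₗ[F] V') : AlgIso (transport e m) m :=
  ⟨e, fun u v => by simp [transport_apply]⟩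

theorem isGroupOf_ofFamily {M : F → F → F → F → Matrix (Fin 5) (Fin 5) F} {h1 hmul hinv}
    {m : (Fin 4 → F) →ₗ[F] (Fin 4 → F) →ₗ[F] (Fin 4 → F)}
    (hm : ∀ x₁ x₂ x₃ x₄, M x₁ x₂ x₃ x₄ = Matrix.of
      ![![1, x₁, x₂, x₃, x₄],
        Matrix.vecCons 0 (![1, 0, 0, 0] + m ![1, 0, 0, 0] ![x₁, x₂, x₃, x₄]),
        Matrix.vecCons 0 (![0, 1, 0, 0] + m ![0, 1, 0, 0] ![x₁, x₂, x₃, x₄]),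
        Matrix.vecCons 0 (![0, 0, 1, 0] + m ![0, 0, 1, 0] ![x₁, x₂, x₃, x₄]),
        Matrix.vecCons 0 (![0, 0, 0, 1] + m ![0, 0, 0, 1] ![x₁, x₂, x₃, x₄])]) :
    IsGroupOf (ofFamily M h1 hmul hinv) m := by
  have h : ∀ x₁ x₂ x₃ x₄, M x₁ x₂ x₃ x₄ =
      aff ![x₁, x₂, x₃, x₄] (LinearMap.id + m.flip ![x₁, x₂, x₃, x₄]) := by
    have e0 : (Pi.single 0 1 : Fin 4 → F) = ![1, 0, 0, 0] := by
      ext i; fin_cases i <;> simp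
    have e1 : (Pi.single 1 1 : Fin 4 → F) = ![0, 1, 0, 0] := by
      ext i; fin_cases i <;> simp
    have e2 : (Pi.single 2 1 : Fin 4 → F) = ![0, 0, 1, 0] := by
      ext i; fin_cases i <;> simp
    have e3 : (Pi.single 3 1 : Fin 4 → F) = ![0, 0, 0, 1] := by
      ext i; fin_cases i <;> simp
    intro x₁ x₂ x₃ x₄
    rw [hm]
    refine congrArg Matrix.of (funext fun i => ?_)
    fin_cases i
    · rfl
    · exact congrArg (fun e => Matrix.vecCons 0 (e + m e ![x₁, x₂, x₃, x₄])) e0.symm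
    · exact congrArg (fun e => Matrix.vecCons 0 (e + m e ![x₁, x₂, x₃, x₄])) e1.symm
    · exact congrArg (fun e => Matrix.vecCons 0 (e + m e ![x₁, x₂, x₃, x₄])) e2.symm
    · exact congrArg (fun e => Matrix.vecCons 0 (e + m e ![x₁, x₂, x₃, x₄])) e3.symm
  constructor
  · rintro g ⟨x₁, x₂, x₃, x₄, hg⟩
    exact ⟨_, hg.trans (h x₁ x₂ x₃ x₄)⟩
  · intro v
    obtain ⟨x, y, z, t, e⟩ := hinv (v 0) (v 1) (v 2) (v 3)
    refine ⟨⟨M (v 0) (v 1) (v 2) (v 3), M x y z t, e, mul_eq_one_comm.1 e⟩, ⟨_, _, _, _, rfl⟩, ?_⟩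
    have hv : ![v 0, v 1, v 2, v 3] = v := by
      ext i
      fin_cases i <;> rfl
    have := h (v 0) (v 1) (v 2) (v 3)
    rwa [hv] at this

/-- The splitting of `F^4` into the first three coordinates and the last one. -/
def splitThree : (Fin 4 → F) ≃ₗ[F] ((Fin 3 → F) × (Fin 1 → F)) where
  toFun v := (![v 0, v 1, v 2], ![v 3])
  invFun p := ![p.1 0, p.1 1, p.1 2, p.2 0]
  map_add' u v := by ext i <;> fin_cases i <;> simp
  map_smul' c v := by ext i <;> fin_cases i <;> simp
  left_inv v := by ext i; fin_cases i <;> simp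
  right_inv p := by ext i <;> fin_cases i <;> simp

/-- The splitting of `F^4` into the first two coordinates and the last two. -/
def splitTwo : (Fin 4 → F) ≃ₗ[F] ((Fin 2 → F) × (Fin 2 → F)) where
  toFun v := (![v 0, v 1], ![v 2, v 3])
  invFun p := ![p.1 0, p.1 1, p.2 0, p.2 1]
  map_add' u v := by ext i <;> fin_cases i <;> simp
  map_smul' c v := by ext i <;> fin_cases i <;> simp
  left_inv v := by ext i; fin_cases i <;> simp
  right_inv p := by ext i <;> fin_cases i <;> simp

/-- The splitting of `F^4` into the first and third coordinates, and the second and fourth. -/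
def splitOdd : (Fin 4 → F) ≃ₗ[F] ((Fin 2 → F) × (Fin 2 → F)) where
  toFun v := (![v 0, v 2], ![v 1, v 3])
  invFun p := ![p.1 0, p.2 0, p.1 1, p.2 1]
  map_add' u v := by ext i <;> fin_cases i <;> simp
  map_smul' c v := by ext i <;> fin_cases i <;> simp
  left_inv v := by ext i; fin_cases i <;> simp
  right_inv p := by ext i <;> fin_cases i <;> simp

/-- The product of the algebra of `U_2(0, 1, 0, c, 1)`. -/
def mulU2 (c : F) : (Fin 4 → F) →ₗ[F] (Fin 4 → F) →ₗ[F] (Fin 4 → F) :=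
  LinearMap.mk₂ F
    (fun u v => ![0, u 0 * v 0, 0, u 0 * (v 1 + v 2) + u 1 * v 0 + c * (u 2 * v 2)])
    (by intros; ext i; fin_cases i <;> simp <;> ring)
    (by intros; ext i; fin_cases i <;> simp <;> ring)
    (by intros; ext i; fin_cases i <;> simp <;> ring)
    (by intros; ext i; fin_cases i <;> simp <;> ring)

theorem mulU2_apply (c : F) (u v : Fin 4 → F) : mulU2 c u v =
    ![0, u 0 * v 0, 0, u 0 * (v 1 + v 2) + u 1 * v 0 + c * (u 2 * v 2)] := rfl

theorem hasAlgebra_U2 (c : F) : HasAlgebra (U2 0 1 0 c 1) (mulU2 c) := by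
  refine ⟨_, isGroupOf_ofFamily (m := mulU2 c) fun x₁ x₂ x₃ x₄ => ?_,
    LinearEquiv.refl F _, fun u v => rfl⟩
  simp [mulU2_apply]

theorem hasAlgebra_RD (D : Matrix (Fin 3) (Fin 3) F) : HasAlgebra (RD D) (zmul ![D]) := by
  refine ⟨_, isGroupOf_ofFamily (m := transport splitThree (zmul ![D])) fun x₁ x₂ x₃ x₄ => ?_,
    transport_algIso _ _⟩
  simp [transport_apply, splitThree, zmul_apply, Matrix.mulVec, dotProduct,
    Fin.sum_univ_succ, add_assoc]

/-- The product on `F^2 × F^2` given by a symmetric and an arbitrary bilinear form. -/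
def pencil (s₀ s₁ s₂ n₀ n₁ n₂ n₃ : F) :
    ((Fin 2 → F) × (Fin 2 → F)) →ₗ[F] ((Fin 2 → F) × (Fin 2 → F)) →ₗ[F]
      ((Fin 2 → F) × (Fin 2 → F)) :=
  zmul ![!![s₀, s₁; s₁, s₂], !![n₀, n₁; n₂, n₃]]

/-- In `U_3` the products lie in the second and fourth coordinates, hence `splitOdd`. -/
theorem hasAlgebra_U3 (α₃ γ₁ γ₃ : F) :
    HasAlgebra (U3 α₃ γ₁ γ₃) (pencil 1 0 0 0 α₃ γ₁ γ₃) := by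
  refine ⟨_, isGroupOf_ofFamily (m := transport splitOdd (pencil _ _ _ _ _ _ _)) fun x₁ x₂ x₃ x₄ => ?_,
    transport_algIso _ _⟩
  simp [transport_apply, splitOdd, pencil, zmul_apply, Matrix.mulVec, dotProduct,
    Fin.sum_univ_succ]

theorem hasAlgebra_U4 (ρ β₁ β₂ : F) :
    HasAlgebra (U4 ρ β₁ β₂) (pencil 1 0 ρ 0 1 β₁ β₂) := by
  refine ⟨_, isGroupOf_ofFamily (m := transport splitTwo (pencil _ _ _ _ _ _ _)) fun x₁ x₂ x₃ x₄ => ?_,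
    transport_algIso _ _⟩
  simp [transport_apply, splitTwo, pencil, zmul_apply, Matrix.mulVec, dotProduct,
    Fin.sum_univ_succ]

theorem hasAlgebra_U5 (α₁ α₂ β₂ : F) :
    HasAlgebra (U5 α₁ α₂ β₂) (pencil 0 1 0 α₁ α₂ 0 β₂) := by
  refine ⟨_, isGroupOf_ofFamily (m := transport splitTwo (pencil _ _ _ _ _ _ _)) fun x₁ x₂ x₃ x₄ => ?_,
    transport_algIso _ _⟩
  simp [transport_apply, splitTwo, pencil, zmul_apply, Matrix.mulVec, dotProduct,
    Fin.sum_univ_succ]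

end Models

/-! ### The case of a nonzero cube. -/

section NilpotencyClassThree

variable {F V : Type*} [Field F] [AddCommGroup V] [Module F V] [FiniteDimensional F V]
  {m : V →ₗ[F] V →ₗ[F] V}

theorem algIso_mulU2_of_table (hV : Module.finrank F V = 4)
    {a b y z : V} {c : F} (hz : z ≠ 0)
    (haa : m a a = b) (hab : m a b = z) (hay : m a y = z) (haz : m a z = 0)
    (hba : m b a = z) (hbb : m b b = 0) (hby : m b y = 0) (hbz : m b z = 0)
    (hya : m y a = 0) (hyb : m y b = 0) (hyy : m y y = c • z) (hyz : m y z = 0)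
    (hza : m z a = 0) (hzb : m z b = 0) (hzy : m z y = 0) (hzz : m z z = 0) :
    AlgIso m (mulU2 c) := by
  -- In a linear relation, right multiplication by `a` twice isolates the coefficient of `a`; right
  -- multiplication once then isolates that of `b`, and left multiplication that of `y`.
  have hli : LinearIndependent F ![a, b, y, z] := by
    rw [Fintype.linearIndependent_iff]
    intro g hg
    simp only [Fin.sum_univ_four, Matrix.cons_val] at hg
    have h1 := congrArg (m a) hg
    have h2 := congrArg (fun x => m x a) hg
    have h3 := congrArg (fun x => m (m x a) a) hg
    simp only [map_add, map_smul, LinearMap.add_apply, LinearMap.smul_apply, haa, hab, hay, haz,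
      hba, hya, hza, map_zero, LinearMap.zero_apply, smul_zero, add_zero] at h1 h2 h3
    have g0 : g 0 = 0 := (smul_eq_zero.1 h3).resolve_right hz
    rw [g0, zero_smul, zero_add] at h1 h2
    have g1 : g 1 = 0 := (smul_eq_zero.1 h2).resolve_right hz
    rw [g1, zero_smul, zero_add] at h1
    have g2 : g 2 = 0 := (smul_eq_zero.1 h1).resolve_right hz
    rw [g0, g1, g2, zero_smul, zero_smul, zero_smul, zero_add, zero_add, zero_add] at hg
    have g3 : g 3 = 0 := (smul_eq_zero.1 hg).resolve_right hz
    intro i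
    fin_cases i
    exacts [g0, g1, g2, g3]
  have hinj : Function.Injective (Fintype.linearCombination F ![a, b, y, z]) :=
    hli.fintypeLinearCombination_injective
  refine AlgIso.symm ⟨LinearEquiv.ofBijective _ ⟨hinj, ?_⟩, fun u v => ?_⟩
  · exact (LinearMap.injective_iff_surjective_of_finrank_eq_finrank (by simp [hV])).1 hinj
  · change Fintype.linearCombination F ![a, b, y, z] _ =
      m (Fintype.linearCombination F ![a, b, y, z] u) (Fintype.linearCombination F ![a, b, y, z] v)
    simp only [Fintype.linearCombination_apply, Fin.sum_univ_four,
      mulU2_apply, Matrix.cons_val, map_add, map_smul, LinearMap.add_apply, LinearMap.smul_apply,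
      haa, hab, hay, haz, hba, hbb, hby, hbz, hya, hyb, hyy, hyz, hza, hzb, hzy, hzz]
    module

/-- Here `D = N²`, `T = N³` is a line and `N⁴ = 0`. Some `a` has `a³ ≠ 0`, so `a²` and `a³` span
`D`. A second generator `y` is adjusted to have `y a = 0`, and only `a y` and `y y`, both multiples
of `a³`, remain to be scaled. -/
theorem exists_algIso_mulU2 (assoc : ∀ u v w, m (m u v) w = m u (m v w))
    (hq : ∀ a, ∃ b, a + b + m a b = 0) (hV : Module.finrank F V = 4)
    (h1 : Module.finrank F (lpow m 1) = 2) (h2 : lpow m 2 ≠ ⊥)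
    (hnc : ∃ u v, m u v ≠ m v u) : AlgIso m (mulU2 (0 : F)) ∨ AlgIso m (mulU2 (1 : F)) := by
  set D := lpow m 1 with hD
  set T := lpow m 2 with hT
  have hDne : D ≠ ⊥ := by
    intro h
    rw [h, finrank_bot] at h1
    omega
  have hTD : T < D := lpow_succ_lt assoc hq hDne
  have hT1 : Module.finrank F T = 1 := by
    have := Submodule.finrank_lt_finrank_of_lt hTD
    have := Submodule.one_le_finrank_iff.2 h2
    omega
  have h3 : lpow m 3 = ⊥ := by
    have := Submodule.finrank_lt_finrank_of_lt (lpow_succ_lt assoc hq h2)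
    rw [← Submodule.finrank_eq_zero (R := F)]
    change Module.finrank F (lpow m 3) < Module.finrank F T at this
    omega
  have mD : ∀ u v, m u v ∈ D := fun u v => Submodule.apply_mem_map₂ m trivial trivial
  have mT : ∀ d ∈ D, ∀ v, m d v ∈ T := fun d hd v => Submodule.apply_mem_map₂ m hd trivial
  have mT' : ∀ d ∈ D, ∀ v, m v d ∈ T := fun d hd v => left_mul_mem_lpow assoc 1 v d hd
  have m0 : ∀ d ∈ T, ∀ v, m d v = 0 := fun d hd v => by
    have : m d v ∈ lpow m 3 := Submodule.apply_mem_map₂ m hd trivial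
    rwa [h3, Submodule.mem_bot] at this
  have m0' : ∀ d ∈ T, ∀ v, m v d = 0 := fun d hd v => by
    have := left_mul_mem_lpow assoc 2 v d hd
    rwa [h3, Submodule.mem_bot] at this
  have hspanT : ∀ t ∈ T, t ≠ 0 → ∀ x ∈ T, ∃ c : F, x = c • t := by
    intro t ht ht0 x hx
    obtain ⟨c, hc⟩ := (finrank_eq_one_iff_of_nonzero' (⟨t, ht⟩ : T)
      (fun h => ht0 (congrArg Subtype.val h))).1 hT1 ⟨x, hx⟩
    exact ⟨c, (congrArg Subtype.val hc).symm⟩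
  have hspanD : ∀ d ∈ D, d ∉ T → ∀ x ∈ D, ∃ c : F, ∃ t ∈ T, x = c • d + t := by
    intro d hd hdT x hx
    have hlt : T < Submodule.span F {d} ⊔ T := lt_of_le_of_ne le_sup_right fun h => hdT <| by
      rw [h]; exact Submodule.mem_sup_left (Submodule.mem_span_singleton_self d)
    have hle : Submodule.span F {d} ⊔ T ≤ D :=
      sup_le ((Submodule.span_singleton_le_iff_mem _ _).2 hd) hTD.le
    have heq : Submodule.span F {d} ⊔ T = D := by
      refine Submodule.eq_of_le_of_finrank_le hle ?_
      have := Submodule.finrank_lt_finrank_of_lt hlt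
      omega
    rw [← heq] at hx
    obtain ⟨_, hs, t, ht, rfl⟩ := Submodule.mem_sup.1 hx
    obtain ⟨c, rfl⟩ := Submodule.mem_span_singleton.1 hs
    exact ⟨c, t, ht, rfl⟩
  obtain ⟨a, haaa⟩ : ∃ a, m (m a a) a ≠ 0 := by
    obtain ⟨u, v, w, huvw⟩ : ∃ u v w, m (m u v) w ≠ 0 := by
      by_contra! h
      have hker : ∀ w, D ≤ LinearMap.ker (m.flip w) := fun w =>
        Submodule.map₂_le.2 fun u _ v _ => h u v w
      exact h2 (eq_bot_iff.2 (Submodule.map₂_le.2 fun d hd w _ =>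
        (Submodule.mem_bot F).2 (hker w hd)))
    -- Modulo `T`, the plane `D` is a line, so right multiplication by `w`, being nonzero on `u v`,
    -- is nonzero on every element of `D` outside `T`. This is applied in turn to `v w` and `w w`,
    -- giving `w³ ≠ 0`.
    have hw : ∀ x ∈ D, x ∉ T → m x w ≠ 0 := by
      intro x hx hxT
      obtain ⟨c, t, ht, he⟩ := hspanD x hx hxT _ (mD u v)
      intro h0
      rw [he, map_add, LinearMap.add_apply, map_smul, LinearMap.smul_apply, h0, m0 t ht] at huvw
      simp at huvw
    have hvw : m v w ∉ T := fun h => huvw (by rw [assoc, m0' _ h])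
    have hvww := hw _ (mD v w) hvw
    have hww : m w w ∉ T := fun h => hvww (by rw [assoc, m0' _ h])
    exact ⟨w, hw _ (mD w w) hww⟩
  have haaT : m a a ∉ T := fun h => haaa (m0 _ h a)
  have hzT : m (m a a) a ∈ T := mT _ (mD _ _) _
  have haD : a ∉ D := fun h => haaT (mT a h a)
  have hsup : D < Submodule.span F {a} ⊔ D := lt_of_le_of_ne le_sup_right fun h => haD <| by
    rw [h]; exact Submodule.mem_sup_left (Submodule.mem_span_singleton_self a)
  obtain ⟨y₀, hy₀⟩ : ∃ y₀, y₀ ∉ Submodule.span F {a} ⊔ D := by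
    by_contra! h
    have htop : Submodule.span F {a} ⊔ D = ⊤ := eq_top_iff.2 fun x _ => h x
    have h4 := Submodule.finrank_add_le_finrank_add_finrank (Submodule.span F {a}) D
    have h5 : Module.finrank F (Submodule.span F {a}) ≤ 1 := by
      simpa using finrank_span_le_card (R := F) ({a} : Set V)
    rw [htop, finrank_top] at h4
    omega
  obtain ⟨α, t, ht, hay₀⟩ := hspanD _ (mD a a) haaT _ (mD a y₀)
  obtain ⟨α', t', ht', hy₀a⟩ := hspanD _ (mD a a) haaT _ (mD y₀ a)
  obtain ⟨β, rfl⟩ := hspanT _ hzT haaa t ht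
  obtain ⟨β', rfl⟩ := hspanT _ hzT haaa t' ht'
  have hazz : ∀ v, m (m (m a a) a) v = 0 := m0 _ hzT
  have hazz' : ∀ v, m v (m (m a a) a) = 0 := m0' _ hzT
  -- Compare the coefficients of `a³` in `(a y₀) a = a (y₀ a)`.
  have hαα : α' = α := by
    have h := assoc a y₀ a
    rw [hay₀, hy₀a] at h
    simp only [map_add, map_smul, LinearMap.add_apply, LinearMap.smul_apply, hazz, hazz',
      smul_zero, add_zero, ← assoc] at h
    exact (smul_left_injective F haaa h).symm
  subst hαα
  set y := y₀ - α' • a - β' • m a a with hy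
  have hya : m y a = 0 := by
    simp only [hy, map_sub, map_smul, LinearMap.sub_apply, LinearMap.smul_apply, hy₀a]
    module
  have hay : m a y = (β - β') • m (m a a) a := by
    simp only [hy, map_sub, map_smul, hay₀, ← assoc]
    module
  -- Otherwise `a` and `y` commute, and they generate the algebra.
  have hb : β - β' ≠ 0 := by
    intro hb
    rw [hb, zero_smul] at hay
    obtain ⟨u, v, huv⟩ := hnc
    refine huv (comm_of_span_sup assoc hq (s := {a, y}) ?_ ?_ u v)
    · rintro _ (rfl | rfl) _ (rfl | rfl) <;> simp [hay, hya]
    · have hlt : Submodule.span F {a} ⊔ D < Submodule.span F {a, y} ⊔ D := by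
        refine lt_of_le_of_ne (sup_le_sup_right (Submodule.span_mono (by simp)) _) fun h => hy₀ ?_
        have hyD : y ∈ Submodule.span F {a} ⊔ D := by
          rw [h]
          exact Submodule.mem_sup_left (Submodule.subset_span (by simp))
        have : y₀ = y + (α' • a + β' • m a a) := by rw [hy]; abel
        rw [this]
        exact Submodule.add_mem _ hyD (Submodule.add_mem_sup
          (Submodule.smul_mem _ _ (Submodule.mem_span_singleton_self a))
          (Submodule.smul_mem _ _ (mD a a)))
      change Submodule.span F {a, y} ⊔ D = ⊤
      refine Submodule.eq_top_of_finrank_eq ?_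
      have h4 := Submodule.finrank_lt_finrank_of_lt hsup
      have h5 := Submodule.finrank_lt_finrank_of_lt hlt
      have h6 := Submodule.finrank_le (Submodule.span F {a, y} ⊔ D)
      omega
  generalize β - β' = b at hay hb
  obtain ⟨γ, t, ht, hyy⟩ := hspanD _ (mD a a) haaT _ (mD y y)
  obtain ⟨δ, rfl⟩ := hspanT _ hzT haaa t ht
  -- In `(a y) y = a (y y)` the left side is zero and the right side is `γ a³`.
  have hγ : γ = 0 := by
    have h := assoc a y y
    rw [hay, hyy] at h
    simp only [map_add, map_smul, LinearMap.smul_apply, hazz, hazz', smul_zero, add_zero,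
      ← assoc] at h
    exact (smul_eq_zero.1 h.symm).resolve_right haaa
  rw [hγ, zero_smul, zero_add] at hyy
  clear_value y
  have hyaa : m y (m a a) = 0 := by rw [← assoc, hya, map_zero, LinearMap.zero_apply]
  have haay : m (m a a) y = 0 := by rw [assoc, hay, map_smul, hazz', smul_zero]
  have haaa' : m a (m a a) = m (m a a) a := (assoc _ _ _).symm
  have haaaa : m (m a a) (m a a) = 0 := by rw [← assoc, hazz]
  -- Rescale `a` by `s` and `y` by `r`; the two equations say that `a y = z` and `y y = c z` for `z
  -- = s³ a³`. For `δ ≠ 0` and `c = 1` they force `r = s² / b` and `s = b² / δ`.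
  have main : ∀ (s r c : F), s ≠ 0 → s * r * b = s ^ 3 → r ^ 2 * δ = c * s ^ 3 →
      AlgIso m (mulU2 c) := by
    intro s r c hs h4 h5
    refine algIso_mulU2_of_table hV (a := s • a) (b := s ^ 2 • m a a) (y := r • y)
      (z := s ^ 3 • m (m a a) a) (smul_ne_zero (pow_ne_zero 3 hs) haaa)
      ?_ ?_ ?_ ?_ ?_ ?_ ?_ ?_ ?_ ?_ ?_ ?_ ?_ ?_ ?_ ?_ <;>
    simp only [map_smul, LinearMap.smul_apply, hazz, hazz', hyaa, haay, haaa', haaaa, hya, hay,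
      hyy, smul_zero, smul_smul] <;> congr 1 <;>
    first | ring1 | linear_combination h4 | linear_combination h5
  by_cases hδ : δ = 0
  · refine Or.inl (main 1 b⁻¹ 0 one_ne_zero ?_ (by rw [hδ]; ring))
    field_simp
  · refine Or.inr (main (b ^ 2 / δ) (b ^ 3 / δ ^ 2) 1 (div_ne_zero (pow_ne_zero 2 hb) hδ) ?_ ?_) <;> field_simp

end NilpotencyClassThree

/-! ### Pencils of bilinear forms on the plane. -/

section Pencils

variable {F : Type*} [Field F]

theorem pencil_algIso {S N S' N' P : Matrix (Fin 2) (Fin 2) F} {a b c d : F} (hP : P.det ≠ 0)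
    (h : a * d - b * c ≠ 0) (hS : P * S' * P.transpose = a • S + b • N)
    (hN : P * N' * P.transpose = c • S + d • N) :
    AlgIso (zmul ![S', N']) (zmul ![S, N]) := by
  refine (zmul_algIso (P := P) (Q := !![a, b; c, d]) hP (by rwa [Matrix.det_fin_two_of])
    fun i => ?_).symm
  fin_cases i <;> simp [Fin.sum_univ_two, hS, hN]

theorem linearIndependent_pencil {S N : Matrix (Fin 2) (Fin 2) F} (hS : S.IsSymm) (hS0 : S ≠ 0)
    (hN : N 0 1 ≠ N 1 0) : LinearIndependent F ![S, N] := by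
  rw [LinearIndependent.pair_iff]
  intro s t hst
  have h1 := congrFun (congrFun hst 0) 1
  have h2 := congrFun (congrFun hst 1) 0
  simp only [Matrix.add_apply, Matrix.smul_apply, Matrix.zero_apply, smul_eq_mul] at h1 h2
  have ht : t = 0 := by
    have h3 : t * (N 0 1 - N 1 0) = 0 := by
      linear_combination h1 - h2 - s * hS.apply 1 0
    exact (mul_eq_zero.1 h3).resolve_right (sub_ne_zero.2 hN)
  rw [ht, zero_smul, add_zero] at hst
  exact ⟨(smul_eq_zero.1 hst).resolve_right hS0, ht⟩

/-- The rows of `P = (x, y; z, w)` realize an isomorphism of two pencils. -/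
def PencilEq (s₀ s₁ s₂ n₀ n₁ n₂ n₃ s₀' s₁' s₂' n₀' n₁' n₂' n₃' x y z w a c d : F) : Prop :=
  x * w - y * z ≠ 0 ∧ a ≠ 0 ∧ d ≠ 0 ∧
  s₀ * x ^ 2 + 2 * s₁ * x * y + s₂ * y ^ 2 = a * s₀' ∧
  s₀ * x * z + s₁ * (x * w + y * z) + s₂ * y * w = a * s₁' ∧
  s₀ * z ^ 2 + 2 * s₁ * z * w + s₂ * w ^ 2 = a * s₂' ∧
  n₀ * x ^ 2 + (n₁ + n₂) * x * y + n₃ * y ^ 2 = c * s₀' + d * n₀' ∧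
  n₀ * x * z + n₁ * x * w + n₂ * y * z + n₃ * y * w = c * s₁' + d * n₁' ∧
  n₀ * x * z + n₁ * y * z + n₂ * x * w + n₃ * y * w = c * s₁' + d * n₂' ∧
  n₀ * z ^ 2 + (n₁ + n₂) * z * w + n₃ * w ^ 2 = c * s₂' + d * n₃'

variable {s₀ s₁ s₂ n₀ n₁ n₂ n₃ s₀' s₁' s₂' n₀' n₁' n₂' n₃' : F}

theorem PencilEq.algIso {x y z w a c d : F}
    (h : PencilEq s₀ s₁ s₂ n₀ n₁ n₂ n₃ s₀' s₁' s₂' n₀' n₁' n₂' n₃' x y z w a c d) :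
    AlgIso (pencil s₀ s₁ s₂ n₀ n₁ n₂ n₃) (pencil s₀' s₁' s₂' n₀' n₁' n₂' n₃') := by
  obtain ⟨h0, ha, hd, e1, e2, e3, e4, e5, e6, e7⟩ := h
  refine pencil_algIso (P := !![x, y; z, w]) (a := a) (b := 0) (c := c) (d := d)
    (by rwa [Matrix.det_fin_two_of]) (by simp [ha, hd]) ?_ ?_
  · ext i j
    fin_cases i <;> fin_cases j <;> simp [Matrix.mul_apply, Fin.sum_univ_two]
    · linear_combination e1
    · linear_combination e2
    · linear_combination e2
    · linear_combination e3
  · ext i j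
    fin_cases i <;> fin_cases j <;> simp [Matrix.mul_apply, Fin.sum_univ_two]
    · linear_combination e4
    · linear_combination e5
    · linear_combination e6
    · linear_combination e7

/-- Congruence preserves symmetry and the second form of the target is not symmetric, so the image
of the symmetric form has no component along it: `Q` is triangular. -/
theorem exists_pencilEq (hs : s₀' ≠ 0 ∨ s₁' ≠ 0 ∨ s₂' ≠ 0) (hn : n₁' ≠ n₂')
    (h : AlgIso (pencil s₀ s₁ s₂ n₀ n₁ n₂ n₃) (pencil s₀' s₁' s₂' n₀' n₁' n₂' n₃')) :
    ∃ x y z w a c d,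
      PencilEq s₀ s₁ s₂ n₀ n₁ n₂ n₃ s₀' s₁' s₂' n₀' n₁' n₂' n₃' x y z w a c d := by
  have hli : LinearIndependent F ![!![s₀', s₁'; s₁', s₂'], !![n₀', n₁'; n₂', n₃']] := by
    refine linearIndependent_pencil ?_ ?_ (by simpa using hn)
    · ext i j
      fin_cases i <;> fin_cases j <;> simp
    · intro h0
      have h1 := congrFun (congrFun h0 0) 0
      have h2 := congrFun (congrFun h0 0) 1
      have h3 := congrFun (congrFun h0 1) 1
      simp at h1 h2 h3
      simp [h1, h2, h3] at hs
  obtain ⟨P, Q, hP, hQ, hPQ⟩ := exists_of_zmul_algIso hli h.symm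
  have hS := hPQ 0
  have hN := hPQ 1
  simp only [Fin.sum_univ_two, Matrix.cons_val_zero, Matrix.cons_val_one] at hS hN
  have entry : ∀ {A B : Matrix (Fin 2) (Fin 2) F}, A = B → ∀ i j, A i j = B i j :=
    fun h i j => by rw [h]
  have a1 := entry hS 0 0
  have a2 := entry hS 0 1
  have a2' := entry hS 1 0
  have a3 := entry hS 1 1
  have b1 := entry hN 0 0
  have b2 := entry hN 0 1
  have b2' := entry hN 1 0
  have b3 := entry hN 1 1
  simp [Matrix.mul_apply, Fin.sum_univ_two] at a1 a2 a2' a3 b1 b2 b2' b3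
  rw [Matrix.det_fin_two] at hP hQ
  have hb : Q 0 1 = 0 := by
    have : Q 0 1 * (n₁' - n₂') = 0 := by linear_combination a2' - a2
    exact (mul_eq_zero.1 this).resolve_right (sub_ne_zero.2 hn)
  rw [hb] at a1 a2 a3 hQ
  refine ⟨P 0 0, P 0 1, P 1 0, P 1 1, Q 0 0, Q 1 0, Q 1 1, hP, ?_, ?_, ?_, ?_, ?_, ?_, ?_, ?_, ?_⟩
  · exact fun h0 => hQ (by rw [h0]; ring)
  · exact fun h0 => hQ (by rw [h0]; ring)
  · linear_combination a1
  · linear_combination a2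
  · linear_combination a3
  · linear_combination b1
  · linear_combination b2
  · linear_combination b2'
  · linear_combination b3

theorem exists_pencil {M : Fin 2 → Matrix (Fin 2) (Fin 2) F} (hM : LinearIndependent F M)
    (hnc : ∃ u v, zmul M u v ≠ zmul M v u) :
    ∃ s₀ s₁ s₂ n₀ n₁ n₂ n₃, (s₀ ≠ 0 ∨ s₁ ≠ 0 ∨ s₂ ≠ 0) ∧ n₁ ≠ n₂ ∧
      AlgIso (zmul M) (pencil s₀ s₁ s₂ n₀ n₁ n₂ n₃) := by
  have hM' : M = ![M 0, M 1] := by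
    ext i; fin_cases i <;> rfl
  set A := M 0
  set B := M 1
  clear_value A B
  subst hM'
  rw [LinearIndependent.pair_iff] at hM
  have hsymm : A 0 1 ≠ A 1 0 ∨ B 0 1 ≠ B 1 0 := by
    by_contra! h
    obtain ⟨u, v, huv⟩ := hnc
    refine huv (Prod.ext rfl (funext fun i => ?_))
    fin_cases i <;> simp [zmul_apply, dotProduct, Matrix.mulVec, Fin.sum_univ_two, h.1, h.2] <;>
      ring
  have key : ∀ A B : Matrix (Fin 2) (Fin 2) F, (∀ s t : F, s • A + t • B = 0 → s = 0 ∧ t = 0) →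
      B 0 1 ≠ B 1 0 → ∃ s₀ s₁ s₂ n₀ n₁ n₂ n₃, (s₀ ≠ 0 ∨ s₁ ≠ 0 ∨ s₂ ≠ 0) ∧ n₁ ≠ n₂ ∧
      AlgIso (zmul ![A, B]) (pencil s₀ s₁ s₂ n₀ n₁ n₂ n₃) := by
    intro A B hM hB
    have hσ : B 0 1 - B 1 0 ≠ 0 := sub_ne_zero.2 hB
    obtain ⟨σ, hσ'⟩ : ∃ σ, σ = B 0 1 - B 1 0 := ⟨_, rfl⟩
    obtain ⟨τ, hτ⟩ : ∃ τ, τ = A 0 1 - A 1 0 := ⟨_, rfl⟩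
    rw [← hσ'] at hσ
    -- With `σ` and `τ` measuring the asymmetry of `B` and `A`, the combination `σ A - τ B` is
    -- symmetric, and it is nonzero by independence.
    refine ⟨σ * A 0 0 - τ * B 0 0, σ * A 0 1 - τ * B 0 1, σ * A 1 1 - τ * B 1 1,
      B 0 0, B 0 1, B 1 0, B 1 1, ?_, hB, ?_⟩
    · by_contra! h
      refine hσ (hM σ (-τ) ?_).1
      ext i j
      fin_cases i <;> fin_cases j <;> simp
      · linear_combination h.1
      · linear_combination h.2.1
      · linear_combination h.2.1 + σ * hτ - τ * hσ'
      · linear_combination h.2.2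
    · refine pencil_algIso (P := 1) (a := σ⁻¹) (b := τ / σ) (c := 0) (d := 1) (by simp)
        (by simpa using hσ) ?_ ?_
      · ext i j
        fin_cases i <;> fin_cases j <;> simp <;> field_simp
        · ring
        · ring
        · linear_combination σ * hτ - τ * hσ'
        · ring
      · ext i j
        fin_cases i <;> fin_cases j <;> simp
  rcases hsymm with h | h
  · obtain ⟨s₀, s₁, s₂, n₀, n₁, n₂, n₃, h1, h2, h3⟩ := key B A
      (fun s t hst => (hM t s (by rwa [add_comm])).symm) h
    refine ⟨s₀, s₁, s₂, n₀, n₁, n₂, n₃, h1, h2, AlgIso.trans ?_ h3⟩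
    exact pencil_algIso (P := 1) (a := 0) (b := 1) (c := 1) (d := 0) (by simp) (by simp) (by simp)
      (by simp)
  · exact key A B hM h

/-! ### Normal forms -/

/-- Complete the square in the symmetric form, then subtract a multiple of it from the other form to
clear that form's first entry. -/
theorem diagonalize (h : s₀ ≠ 0) (hn : n₁ ≠ n₂) : ∃ ρ a b c : F, a ≠ b ∧
    AlgIso (pencil s₀ s₁ s₂ n₀ n₁ n₂ n₃) (pencil 1 0 ρ 0 a b c) := by
  obtain ⟨t, rfl⟩ : ∃ t, s₁ = t * s₀ := ⟨s₁ / s₀, by field_simp⟩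
  obtain ⟨ρ, rfl⟩ : ∃ ρ, s₂ = (ρ + t ^ 2) * s₀ := ⟨s₂ / s₀ - t ^ 2, by field_simp; ring⟩
  refine ⟨ρ, n₁ - t * n₀, n₂ - t * n₀, n₃ - t * (n₁ + n₂) + t ^ 2 * n₀ - ρ * n₀,
    fun he => hn (by linear_combination he), PencilEq.algIso
      (x := 1) (y := 0) (z := -t) (w := 1) (a := s₀) (c := n₀) (d := 1) ?_⟩
  refine ⟨by simp, h, one_ne_zero, ?_, ?_, ?_, ?_, ?_, ?_, ?_⟩ <;> ring

theorem exists_diagonal_or_alternating (hs : s₀ ≠ 0 ∨ s₁ ≠ 0 ∨ s₂ ≠ 0) (hn : n₁ ≠ n₂) :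
    (∃ ρ a b c : F, a ≠ b ∧ AlgIso (pencil s₀ s₁ s₂ n₀ n₁ n₂ n₃) (pencil 1 0 ρ 0 a b c)) ∨
    ((2 : F) = 0 ∧ ∃ a b c d : F, b ≠ c ∧
      AlgIso (pencil s₀ s₁ s₂ n₀ n₁ n₂ n₃) (pencil 0 1 0 a b c d)) := by
  by_cases h0 : s₀ = 0
  swap
  · exact Or.inl (diagonalize h0 hn)
  by_cases h2 : s₂ = 0
  swap
  · obtain ⟨ρ, a, b, c, hab, h⟩ := diagonalize (s₁ := s₁) (s₂ := s₀) (n₀ := n₃) (n₃ := n₀) h2 hn.symm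
    refine Or.inl ⟨ρ, a, b, c, hab, AlgIso.trans (PencilEq.algIso
      (x := 0) (y := 1) (z := 1) (w := 0) (a := 1) (c := 0) (d := 1) ?_) h⟩
    refine ⟨by simp, one_ne_zero, one_ne_zero, ?_, ?_, ?_, ?_, ?_, ?_, ?_⟩ <;> ring
  have h1 : s₁ ≠ 0 := by tauto
  subst h0 h2
  by_cases hc : (2 : F) = 0
  · refine Or.inr ⟨hc, n₀, n₁, n₂, n₃, hn, PencilEq.algIso
      (x := 1) (y := 0) (z := 0) (w := 1) (a := s₁) (c := 0) (d := 1) ?_⟩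
    refine ⟨by simp, h1, one_ne_zero, ?_, ?_, ?_, ?_, ?_, ?_, ?_⟩ <;> ring
  -- For a hyperbolic plane, the sum of the two basis vectors has the nonzero value `2 s₁`.
  · obtain ⟨ρ, a, b, c, hab, h⟩ := diagonalize (s₀ := 2 * s₁) (s₁ := s₁) (s₂ := 0)
      (n₀ := n₀ + n₁ + n₂ + n₃) (n₁ := n₁ + n₃) (n₂ := n₂ + n₃) (n₃ := n₃)
      (mul_ne_zero hc h1) (fun he => hn (by linear_combination he))
    refine Or.inl ⟨ρ, a, b, c, hab, AlgIso.trans (PencilEq.algIso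
      (x := 1) (y := 1) (z := 0) (w := 1) (a := 1) (c := 0) (d := 1) ?_) h⟩
    refine ⟨by simp, one_ne_zero, one_ne_zero, ?_, ?_, ?_, ?_, ?_, ?_, ?_⟩ <;> ring

theorem rankOne_normal_form {a b c : F} (hab : a ≠ b) :
    AlgIso (pencil 1 0 0 0 a b c) (pencil 1 0 0 0 0 1 0) ∨
    AlgIso (pencil 1 0 0 0 a b c) (pencil 1 0 0 0 0 1 1) ∨
    ∃ l, l ≠ 1 ∧ AlgIso (pencil 1 0 0 0 a b c) (pencil 1 0 0 0 1 l 0) := by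
  have hba : b - a ≠ 0 := sub_ne_zero.2 hab.symm
  by_cases hc : c = 0
  · subst hc
    by_cases ha : a = 0
    · subst ha
      refine Or.inl (PencilEq.algIso
        (x := 1) (y := 0) (z := 0) (w := 1) (a := 1) (c := 0) (d := b) ?_)
      refine ⟨by simp, one_ne_zero, hab.symm, ?_, ?_, ?_, ?_, ?_, ?_, ?_⟩ <;> ring
    · refine Or.inr (Or.inr ⟨b / a, fun h => hab ((div_eq_one_iff_eq ha).1 h).symm,
        PencilEq.algIso (x := 1) (y := 0) (z := 0) (w := 1) (a := 1) (c := 0) (d := a) ?_⟩)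
      refine ⟨by simp, one_ne_zero, ha, ?_, ?_, ?_, ?_, ?_, ?_, ?_⟩ <;> field_simp <;> ring
  -- The new first basis vector `(x, y)` solves `a x + c y = 0` and `b x + c y = c`, which turns the
  -- off-diagonal entries into `0` and `c`.
  · have h1 : a * (c / (b - a)) + c * (-a / (b - a)) = 0 := by ring
    have h2 : b * (c / (b - a)) + c * (-a / (b - a)) = c := by field_simp; ring
    generalize hx : c / (b - a) = x at h1 h2
    generalize -a / (b - a) = y at h1 h2
    have hx0 : x ≠ 0 := by rw [← hx]; exact div_ne_zero hc hba
    refine Or.inr (Or.inl (PencilEq.algIso (x := x) (y := y) (z := 0) (w := 1) (a := x ^ 2)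
      (c := (a + b) * x * y + c * y ^ 2) (d := c) ?_))
    refine ⟨by simpa using hx0, pow_ne_zero 2 hx0, hc, by ring, by ring, by ring, by ring, ?_, ?_,
      by ring⟩
    · linear_combination h1
    · linear_combination h2

theorem rankTwo_normal_form {ρ q k a b c : F} (hρ : ρ ≠ 0) (hk : k ≠ 0) (hq : ρ = q * k ^ 2)
    (hab : a ≠ b) : ∃ β₁ β₂ : F, β₁ ≠ 1 ∧
      AlgIso (pencil 1 0 ρ 0 a b c) (pencil 1 0 q 0 1 β₁ β₂) := by
  have hq0 : q ≠ 0 := by rintro rfl; simp at hq; exact hρ hq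
  subst hq
  by_cases ha : a = 0
  · subst ha
    -- Swapping the basis vectors puts the nonzero off-diagonal entry first. The new vectors have
    -- values `q` and `q²`, that is, `q` times the form `diag(1, q)`.
    refine ⟨0, -c / (b * k), zero_ne_one, PencilEq.algIso (x := 0) (y := k⁻¹) (z := q)
      (w := 0) (a := q) (c := c / k ^ 2) (d := b * q / k) ?_⟩
    have hb : b ≠ 0 := hab.symm
    refine ⟨by simp [hk, hq0], hq0, div_ne_zero (mul_ne_zero hb hq0) hk,
      ?_, ?_, ?_, ?_, ?_, ?_, ?_⟩ <;> field_simp <;> ring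
  · refine ⟨b / a, c / (a * k), fun h => hab ((div_eq_one_iff_eq ha).1 h).symm,
      PencilEq.algIso (x := 1) (y := 0) (z := 0) (w := k⁻¹) (a := 1) (c := 0) (d := a / k) ?_⟩
    refine ⟨by simp [hk], one_ne_zero, div_ne_zero ha hk,
      ?_, ?_, ?_, ?_, ?_, ?_, ?_⟩ <;> field_simp <;> ring

/-- The rows `(t, 1)` and `μ (-ρ, t)`, with `μ = ±1`, are orthogonal for `x² + ρy²` with values `t²
+ ρ` and `ρ (t² + ρ)`: they form a similitude. The formulas for `β₃` and `β₄` are its effect on the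
second form modulo the first. -/
theorem DivRel.algIso {ρ β₁ β₂ β₃ β₄ : F} (h : DivRel ρ (β₁, β₂) (β₃, β₄)) :
    AlgIso (pencil 1 0 ρ 0 1 β₁ β₂) (pencil 1 0 ρ 0 1 β₃ β₄) := by
  have key : ∀ μ : F, μ ^ 2 = 1 → ∀ t : F, (t ^ 2 + ρ) * (t ^ 2 + β₂ * t - ρ * β₁) ≠ 0 →
      β₃ = (β₁ * t ^ 2 + β₂ * t - ρ) / (t ^ 2 + β₂ * t - ρ * β₁) →
      β₄ = μ * ((β₂ * t ^ 2 - 2 * ρ * (β₁ + 1) * t - ρ * β₂) / (t ^ 2 + β₂ * t - ρ * β₁)) →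
      AlgIso (pencil 1 0 ρ 0 1 β₁ β₂) (pencil 1 0 ρ 0 1 β₃ β₄) := by
    intro μ hμ t ht h3 h4
    obtain ⟨ht1, ht2⟩ := mul_ne_zero_iff.1 ht
    have hμ0 : μ ≠ 0 := by rintro rfl; simp at hμ
    rw [mul_div_assoc', eq_div_iff ht2] at h4
    rw [eq_div_iff ht2] at h3
    refine PencilEq.algIso (x := t) (y := 1) (z := -(μ * ρ)) (w := μ * t) (a := t ^ 2 + ρ)
      (c := (1 + β₁) * t + β₂) (d := μ * (t ^ 2 + β₂ * t - ρ * β₁)) ?_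
    refine ⟨?_, ht1, mul_ne_zero hμ0 ht2, by ring, by ring, ?_, by ring, by ring, ?_, ?_⟩
    · have : t * (μ * t) - 1 * -(μ * ρ) = μ * (t ^ 2 + ρ) := by ring
      rw [this]
      exact mul_ne_zero hμ0 ht1
    · linear_combination (ρ ^ 2 + ρ * t ^ 2) * hμ
    · linear_combination (-μ) * h3
    · linear_combination (-μ) * h4 + (ρ * (β₁ + 1) * t + ρ * β₂) * hμ
  rcases h with ⟨h3, h4⟩ | ⟨t, ht, h3, h4 | h4⟩
  · simp only at h3 h4
    subst h3
    rcases h4 with h4 | h4 <;> subst h4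
    · exact ⟨LinearEquiv.refl F _, fun _ _ => rfl⟩
    · refine PencilEq.algIso (x := 1) (y := 0) (z := 0) (w := -1) (a := 1) (c := 0) (d := -1) ?_
      refine ⟨by simp, one_ne_zero, by simp, ?_, ?_, ?_, ?_, ?_, ?_, ?_⟩ <;> ring
  · exact key 1 (by ring) t ht h3 (by rw [one_mul]; exact h4)
  · exact key (-1) (by ring) t ht h3 (by rw [neg_one_mul]; exact h4)

theorem alternating_normal_form {a b c d : F} (h2 : (2 : F) = 0) (hbc : b ≠ c) :
    ∃ ε, AlgIso (pencil 0 1 0 a b c d) (pencil 0 1 0 1 1 0 ε) := by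
  have key : ∀ a b c d : F, b ≠ c → a ≠ 0 →
      ∃ ε, AlgIso (pencil 0 1 0 a b c d) (pencil 0 1 0 1 1 0 ε) := by
    intro a b c d hbc ha
    have he : b - c ≠ 0 := sub_ne_zero.2 hbc
    have h2e : b + c = b - c := by linear_combination c * h2
    obtain ⟨e, rfl⟩ : ∃ e, b = e + c := ⟨b - c, by ring⟩
    rw [add_sub_cancel_right] at he h2e
    refine ⟨a * d / e ^ 2, PencilEq.algIso (x := 1) (y := 0) (z := 0) (w := a / e) (a := a / e)
      (c := c * a / e) (d := a) ?_⟩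
    refine ⟨by simp [ha, he], div_ne_zero ha he, ha, ?_, ?_, ?_, ?_, ?_, ?_, ?_⟩ <;>
      field_simp <;> ring
  by_cases ha : a = 0
  swap
  · exact key a b c d hbc ha
  by_cases hd : d = 0
  -- With both diagonal entries zero, the second form takes the value `b + c` on the sum of the
  -- basis vectors, and in characteristic 2 this equals `b - c ≠ 0`.
  · have hbc' : b + c ≠ 0 := fun h => hbc (by linear_combination h - c * h2)
    obtain ⟨ε, h⟩ := key (b + c) b c 0 hbc hbc'
    refine ⟨ε, AlgIso.trans (PencilEq.algIso (x := 1) (y := 1) (z := 0) (w := 1) (a := 1)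
      (c := 0) (d := 1) ?_) h⟩
    subst ha hd
    refine ⟨by simp, one_ne_zero, one_ne_zero, ?_, ?_, ?_, ?_, ?_, ?_, ?_⟩
    · linear_combination h2
    all_goals ring
  · obtain ⟨ε, h⟩ := key d c b a hbc.symm hd
    refine ⟨ε, AlgIso.trans (PencilEq.algIso (x := 0) (y := 1) (z := 1) (w := 0) (a := 1)
      (c := 0) (d := 1) ?_) h⟩
    refine ⟨by simp, one_ne_zero, one_ne_zero, ?_, ?_, ?_, ?_, ?_, ?_, ?_⟩ <;> ring

theorem ArtinSchreierRel.algIso {ε ε' : F} (h2 : (2 : F) = 0) (h : ArtinSchreierRel ε ε') :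
    AlgIso (pencil 0 1 0 1 1 0 ε) (pencil 0 1 0 1 1 0 ε') := by
  obtain ⟨u, rfl⟩ := h
  refine PencilEq.algIso (x := 1) (y := 0) (z := u) (w := 1) (a := 1) (c := u) (d := 1) ?_
  refine ⟨by simp, one_ne_zero, one_ne_zero, ?_, ?_, ?_, ?_, ?_, ?_, ?_⟩
  · ring
  · ring
  · linear_combination u * h2
  · ring
  · ring
  · ring
  · linear_combination (u ^ 2 + u) * h2

/-! ### Distinctness -/

/-- The radical of the symmetric form is preserved, which forces `z = 0`. The relations that remain
show that vanishing of `γ₃` is invariant and, when it vanishes, so is the ratio of `α` to `γ₁`. -/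
theorem rankOne_unique {α γ₁ γ₃ α' γ₁' γ₃' : F} (hn : α' ≠ γ₁')
    (h : AlgIso (pencil 1 0 0 0 α γ₁ γ₃) (pencil 1 0 0 0 α' γ₁' γ₃')) :
    ∃ k l d y z : F, k ≠ 0 ∧ l ≠ 0 ∧ d ≠ 0 ∧ γ₃ * l = d * γ₃' ∧ α * k + γ₃ * y = d * α' ∧
      γ₁ * k + γ₃ * z = d * γ₁' := by
  obtain ⟨x, y, z, w, a, c, d, h0, ha, hd, -, -, e3, -, e5, e6, e7⟩ :=
    exists_pencilEq (Or.inl one_ne_zero) hn h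
  have hz : z = 0 := by
    have : z ^ 2 = 0 := by linear_combination e3
    exact pow_eq_zero_iff two_ne_zero |>.1 this
  subst hz
  have hxw : x * w ≠ 0 := by simpa using h0
  refine ⟨x * w, w ^ 2, d, y * w, y * w, hxw, pow_ne_zero 2 (right_ne_zero_of_mul hxw), hd, ?_, ?_,
    ?_⟩
  · linear_combination e7
  · linear_combination e5
  · linear_combination e6

theorem not_rankOne_algIso_rankTwo {ρ : F} (hρ : ρ ≠ 0) (hn : n₁' ≠ n₂') :
    ¬ AlgIso (pencil 1 0 0 n₀ n₁ n₂ n₃) (pencil 1 0 ρ n₀' n₁' n₂' n₃') := by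
  intro h
  obtain ⟨x, y, z, w, a, c, d, h0, ha, hd, e1, e2, e3, -⟩ :=
    exists_pencilEq (Or.inl one_ne_zero) hn h
  have h1 : a ^ 2 * ρ = 0 := by
    linear_combination x * z * e2 - a * e3 - z ^ 2 * e1
  exact mul_ne_zero (pow_ne_zero 2 ha) hρ h1

theorem not_rankOne_algIso_alternating (hn : n₁' ≠ n₂') :
    ¬ AlgIso (pencil 1 0 0 n₀ n₁ n₂ n₃) (pencil 0 1 0 n₀' n₁' n₂' n₃') := by
  intro h
  obtain ⟨x, y, z, w, a, c, d, h0, ha, hd, e1, e2, e3, -⟩ :=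
    exists_pencilEq (Or.inr (Or.inl one_ne_zero)) hn h
  have hx : x = 0 := by
    have : x ^ 2 = 0 := by linear_combination e1
    exact pow_eq_zero_iff two_ne_zero |>.1 this
  subst hx
  exact ha (by linear_combination -e2)

/-- In characteristic 2 the form `2xy` takes only the value zero. -/
theorem not_alternating_algIso_diagonal {ρ : F} (h2 : (2 : F) = 0) (hn : n₁' ≠ n₂') :
    ¬ AlgIso (pencil 0 1 0 n₀ n₁ n₂ n₃) (pencil 1 0 ρ n₀' n₁' n₂' n₃') := by
  intro h
  obtain ⟨x, y, z, w, a, c, d, h0, ha, hd, e1, -⟩ := exists_pencilEq (Or.inl one_ne_zero) hn h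
  exact ha (by linear_combination x * y * h2 - e1)

/-- Compare the determinants of the symmetric forms: `ρ (det P)² = a² ρ'`. -/
theorem squareRel_of_algIso {ρ ρ' : F} (hn : n₁' ≠ n₂')
    (h : AlgIso (pencil 1 0 ρ n₀ n₁ n₂ n₃) (pencil 1 0 ρ' n₀' n₁' n₂' n₃')) :
    SquareRel ρ ρ' := by
  obtain ⟨x, y, z, w, a, c, d, h0, ha, hd, e1, e2, e3, -⟩ :=
    exists_pencilEq (Or.inl one_ne_zero) hn h
  refine ⟨a / (x * w - y * z), div_ne_zero ha h0, ?_⟩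
  rw [div_pow, mul_div_assoc', eq_div_iff (pow_ne_zero 2 h0)]
  linear_combination a * e3 + (z ^ 2 + ρ * w ^ 2) * e1 - (x * z + ρ * y * w) * e2

/-- Every similitude of `x² + ρy²` has rows `(x, y)` and `μ (-ρy, x)` with `μ = ±1`. The case `y =
0` is the sign change of `β₂`; otherwise `t = x / y` is the parameter of the relation. -/
theorem divRel_of_algIso {ρ β₁ β₂ β₃ β₄ : F} (hρ : ρ ≠ 0) (hβ : β₃ ≠ 1)
    (h : AlgIso (pencil 1 0 ρ 0 1 β₁ β₂) (pencil 1 0 ρ 0 1 β₃ β₄)) :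
    DivRel ρ (β₁, β₂) (β₃, β₄) := by
  obtain ⟨x, y, z, w, a, c, d, h0, ha, hd, e1, e2, e3, e4, e5, e6, e7⟩ :=
    exists_pencilEq (Or.inl one_ne_zero) hβ.symm h
  have hw : a * w = x * (x * w - y * z) := by linear_combination y * e2 - w * e1
  have hz : a * z = -ρ * y * (x * w - y * z) := by linear_combination x * e2 - z * e1
  have hΔ : (x * w - y * z) ^ 2 = a ^ 2 := by
    refine mul_left_cancel₀ hρ ?_
    linear_combination a * e3 + (z ^ 2 + ρ * w ^ 2) * e1 - (x * z + ρ * y * w) * e2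
  obtain ⟨μ, hμ, hμΔ⟩ : ∃ μ : F, (μ = 1 ∨ μ = -1) ∧ x * w - y * z = μ * a := by
    rcases sq_eq_sq_iff_eq_or_eq_neg.1 hΔ with h | h
    · exact ⟨1, Or.inl rfl, by rw [h]; ring⟩
    · exact ⟨-1, Or.inr rfl, by rw [h]; ring⟩
  rw [hμΔ] at hw hz
  obtain rfl : w = μ * x := mul_left_cancel₀ ha (by linear_combination hw)
  obtain rfl : z = -(μ * ρ * y) := mul_left_cancel₀ ha (by linear_combination hz)
  have hμ2 : μ ^ 2 = 1 := by rcases hμ with rfl | rfl <;> ring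
  have hμ0 : μ ≠ 0 := by rintro rfl; simp at hμ2
  have f1 : x ^ 2 + β₂ * x * y - ρ * β₁ * y ^ 2 = μ * d := by
    linear_combination μ * e5 - (x ^ 2 + β₂ * x * y - ρ * β₁ * y ^ 2) * hμ2
  have f2 : β₁ * x ^ 2 + β₂ * x * y - ρ * y ^ 2 = μ * d * β₃ := by
    linear_combination μ * e6 - (β₁ * x ^ 2 + β₂ * x * y - ρ * y ^ 2) * hμ2
  -- Subtracting `ρ` times `e4` eliminates `c`, the multiple of the symmetric form.
  have f3 : β₂ * x ^ 2 - 2 * ρ * (β₁ + 1) * x * y - ρ * β₂ * y ^ 2 = d * β₄ := by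
    linear_combination e7 - ρ * e4 - (β₂ * x ^ 2 - ρ * (β₁ + 1) * x * y) * hμ2
  by_cases hy : y = 0
  · subst hy
    have hx2 : x ^ 2 = μ * d := by linear_combination f1
    have hd' : μ * d ≠ 0 := mul_ne_zero hμ0 hd
    left
    refine ⟨mul_left_cancel₀ hd' (by linear_combination β₁ * hx2 - f2), ?_⟩
    have h4 : β₄ = μ * β₂ := mul_left_cancel₀ hd (by linear_combination β₂ * hx2 - f3)
    rcases hμ with rfl | rfl
    · exact Or.inl (by rw [h4]; ring)
    · exact Or.inr (by rw [h4]; ring)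
  · right
    obtain ⟨t, rfl⟩ : ∃ t, x = t * y := ⟨x / y, by field_simp⟩
    have hy2 : y ^ 2 ≠ 0 := pow_ne_zero 2 hy
    have hden : t ^ 2 + β₂ * t - ρ * β₁ ≠ 0 := by
      intro h
      refine mul_ne_zero hμ0 hd ?_
      linear_combination y ^ 2 * h - f1
    refine ⟨t, mul_ne_zero ?_ hden, ?_, ?_⟩
    · intro h
      refine ha ?_
      linear_combination y ^ 2 * h - e1
    · rw [eq_div_iff hden]
      refine mul_left_cancel₀ hy2 ?_
      linear_combination β₃ * f1 - f2
    · have h4 : β₄ * (t ^ 2 + β₂ * t - ρ * β₁) =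
          μ * (β₂ * t ^ 2 - 2 * ρ * (β₁ + 1) * t - ρ * β₂) := by
        refine mul_left_cancel₀ hy2 ?_
        linear_combination β₄ * f1 - μ * f3
      rcases hμ with rfl | rfl
      · left
        rw [eq_div_iff hden]
        linear_combination h4
      · right
        rw [← neg_div, eq_div_iff hden]
        linear_combination h4

theorem artinSchreierRel_of_algIso {ε ε' : F}
    (h : AlgIso (pencil 0 1 0 1 1 0 ε) (pencil 0 1 0 1 1 0 ε')) : ArtinSchreierRel ε' ε := by
  obtain ⟨x, y, z, w, a, c, d, h0, ha, hd, e1, e2, e3, e4, e5, e6, e7⟩ :=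
    exists_pencilEq (Or.inr (Or.inl one_ne_zero)) one_ne_zero h
  refine ⟨-(x * z + x * w + ε * y * w) / d, ?_⟩
  field_simp
  have hd' : x * w - y * z = d := by linear_combination e5 - e6
  have hU : x ^ 2 + x * y + ε * y ^ 2 = d := by linear_combination e4
  have hV : z ^ 2 + z * w + ε * w ^ 2 = d * ε' := by linear_combination e7
  -- Multiplicativity of the norm form `x² + xy + εy²`. The two factors are `d` and `d ε'` and the
  -- determinant is `d`, so division by `d²` exhibits the Artin–Schreier difference.
  have key : (x ^ 2 + x * y + ε * y ^ 2) * (z ^ 2 + z * w + ε * w ^ 2) =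
      (x * z + x * w + ε * y * w) ^ 2 - (x * z + x * w + ε * y * w) * (x * w - y * z) +
        ε * (x * w - y * z) ^ 2 := by ring
  rw [hU, hV, hd'] at key
  linear_combination key

end Pencils

/-! ### Classification of the algebras and separation of the labels. -/

section Classification

variable {F : Type*} [Field F]

theorem AlgIso.noncomm {V V' : Type*} [AddCommGroup V] [Module F V] [AddCommGroup V'] [Module F V']
    {m : V →ₗ[F] V →ₗ[F] V} {m' : V' →ₗ[F] V' →ₗ[F] V'} (h : AlgIso m m')
    (hnc : ∃ u v, m u v ≠ m v u) : ∃ u v, m' u v ≠ m' v u := by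
  obtain ⟨φ, hφ⟩ := h
  obtain ⟨u, v, huv⟩ := hnc
  refine ⟨φ u, φ v, fun he => huv ?_⟩
  rw [← hφ, ← hφ] at he
  exact φ.injective he

theorem zmul_noncomm_iff {n : ℕ} {D : Matrix (Fin n) (Fin n) F} :
    (∃ u v, zmul ![D] u v ≠ zmul ![D] v u) ↔ ¬ D.IsSymm := by
  rw [← not_iff_not]
  push Not
  constructor
  · intro h
    ext i j
    have h1 := congrFun (Prod.ext_iff.1 (h (Pi.single j 1, 0) (Pi.single i 1, 0))).2 0
    simpa [zmul_apply] using h1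
  · intro h u v
    refine Prod.ext rfl (funext fun i => ?_)
    fin_cases i
    change u.1 ⬝ᵥ D.mulVec v.1 = v.1 ⬝ᵥ D.mulVec u.1
    rw [Matrix.dotProduct_mulVec, ← Matrix.mulVec_transpose, h.eq, dotProduct_comm]

theorem algebra_classification {V : Type*} [AddCommGroup V] [Module F V] [FiniteDimensional F V]
    {m : V →ₗ[F] V →ₗ[F] V} (assoc : ∀ u v w, m (m u v) w = m u (m v w))
    (hq : ∀ a, ∃ b, a + b + m a b = 0) (hV : Module.finrank F V = 4)
    (hnc : ∃ u v, m u v ≠ m v u) :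
    (AlgIso m (mulU2 (0 : F)) ∨ AlgIso m (mulU2 (1 : F))) ∨
    (∃ D : Matrix (Fin 3) (Fin 3) F, ¬ D.IsSymm ∧ AlgIso m (zmul ![D])) ∨
    ∃ s₀ s₁ s₂ n₀ n₁ n₂ n₃ : F, (s₀ ≠ 0 ∨ s₁ ≠ 0 ∨ s₂ ≠ 0) ∧ n₁ ≠ n₂ ∧
      AlgIso m (pencil s₀ s₁ s₂ n₀ n₁ n₂ n₃) := by
  have mD : ∀ u v, m u v ∈ lpow m 1 := fun u v => Submodule.apply_mem_map₂ m trivial trivial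
  have h0 : lpow m 1 ≠ ⊥ := by
    intro h
    obtain ⟨u, v, huv⟩ := hnc
    refine huv ?_
    have h1 := mD u v
    have h2 := mD v u
    rw [h, Submodule.mem_bot] at h1 h2
    rw [h1, h2]
  have hne : Module.finrank F (lpow m 1) ≠ 3 := by
    intro h
    obtain ⟨u, v, huv⟩ := hnc
    exact huv (comm_of_finrank_lpow_one assoc hq (by omega) u v)
  have htop : lpow m 0 ≠ ⊥ := by
    intro h
    refine h0 (eq_bot_iff.2 ?_)
    rw [← h]
    exact le_top
  have hlt := Submodule.finrank_lt_finrank_of_lt (lpow_succ_lt assoc hq htop)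
  have hle : Module.finrank F (lpow m 0) = 4 := by
    rw [← hV]
    exact finrank_top F V
  have hpos := Submodule.one_le_finrank_iff.2 h0
  rw [zero_add] at hlt
  by_cases hT : lpow m 2 = ⊥
  · have h3 : ∀ u v w, m (m u v) w = 0 := by
      intro u v w
      have h : m (m u v) w ∈ lpow m 2 := Submodule.apply_mem_map₂ m (mD u v) trivial
      rwa [hT, Submodule.mem_bot] at h
    right
    have hk : Module.finrank F (lpow m 1) = 1 ∨ Module.finrank F (lpow m 1) = 2 := by omega
    rcases hk with hk | hk
    · obtain ⟨M, -, hM⟩ := exists_algIso_zmul (n := 3) (k := 1) assoc h3 hV hk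
      have hM' : M = ![M 0] := by
        ext i; fin_cases i; rfl
      rw [hM'] at hM
      exact Or.inl ⟨M 0, zmul_noncomm_iff.1 (hM.noncomm hnc), hM⟩
    · obtain ⟨M, hM0, hM⟩ := exists_algIso_zmul (n := 2) (k := 2) assoc h3 hV hk
      obtain ⟨s₀, s₁, s₂, n₀, n₁, n₂, n₃, h1, h2, h3⟩ := exists_pencil hM0 (hM.noncomm hnc)
      exact Or.inr ⟨s₀, s₁, s₂, n₀, n₁, n₂, n₃, h1, h2, hM.trans h3⟩
  · left
    have h1 : lpow m 2 < lpow m 1 := lpow_succ_lt assoc hq h0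
    have h2 := Submodule.finrank_lt_finrank_of_lt h1
    have h4 := Submodule.one_le_finrank_iff.2 hT
    exact exists_algIso_mulU2 assoc hq hV (by omega) hT hnc

/-! ### Invariants -/

/-- The cube of the first basis vector is nonzero, whereas all triple products vanish for `zmul`. -/
theorem not_mulU2_algIso_zmul {n k : ℕ} {c : F} {M : Fin k → Matrix (Fin n) (Fin n) F} :
    ¬ AlgIso (mulU2 c) (zmul M) := by
  rintro ⟨φ, hφ⟩
  have h : mulU2 c (mulU2 c ![1, 0, 0, 0] ![1, 0, 0, 0]) ![1, 0, 0, 0] = 0 := by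
    refine φ.injective ?_
    rw [hφ, hφ, map_zero, zmul_apply, zmul_apply]
    refine Prod.ext rfl (funext fun i => ?_)
    simp
  have h3 := congrFun h 3
  simp [mulU2_apply] at h3

theorem not_mulU2_algIso_pencil {c s₀ s₁ s₂ n₀ n₁ n₂ n₃ : F} :
    ¬ AlgIso (mulU2 c) (pencil s₀ s₁ s₂ n₀ n₁ n₂ n₃) :=
  not_mulU2_algIso_zmul

/-- For `c = 0`, every element annihilating all products from the left has square zero; for `c = 1`
the third basis vector annihilates them and has nonzero square. -/
theorem not_mulU2_zero_algIso_one : ¬ AlgIso (mulU2 (0 : F)) (mulU2 (1 : F)) := by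
  rintro ⟨φ, hφ⟩
  have h1 : ∀ w w', mulU2 (1 : F) ![0, 0, 1, 0] (mulU2 1 w w') = 0 := by
    intro w w'
    ext i
    fin_cases i <;> simp [mulU2_apply]
  have h2 : φ.symm ![0, 0, 1, 0] 0 = 0 := by
    have h3 : mulU2 (0 : F) (φ.symm ![0, 0, 1, 0]) (mulU2 0 ![1, 0, 0, 0] ![1, 0, 0, 0]) = 0 := by
      refine φ.injective ?_
      rw [hφ, hφ, LinearEquiv.apply_symm_apply, h1, map_zero]
    have h4 := congrFun h3 3
    simpa [mulU2_apply] using h4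
  have h3 : mulU2 (0 : F) (φ.symm ![0, 0, 1, 0]) (φ.symm ![0, 0, 1, 0]) = 0 := by
    ext i
    fin_cases i <;> simp [mulU2_apply, h2]
  have h4 := hφ (φ.symm ![0, 0, 1, 0]) (φ.symm ![0, 0, 1, 0])
  rw [h3, map_zero, LinearEquiv.apply_symm_apply] at h4
  have h5 := congrFun h4 3
  simp [mulU2_apply] at h5

/-- With one form, all products are multiples of a single vector `z`. In the pencil the asymmetry of
the second form then forces the first coordinate of `z` to vanish, and with it the symmetric form.
-/
theorem not_zmul_one_algIso_pencil {n : ℕ} {D : Matrix (Fin n) (Fin n) F}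
    {s₀ s₁ s₂ n₀ n₁ n₂ n₃ : F} (hs : s₀ ≠ 0 ∨ s₁ ≠ 0 ∨ s₂ ≠ 0) (hn : n₁ ≠ n₂) :
    ¬ AlgIso (zmul ![D]) (pencil s₀ s₁ s₂ n₀ n₁ n₂ n₃) := by
  rintro ⟨φ, hφ⟩
  have key : ∀ u v : Fin 2 → F, ∃ c : F, c • (φ (0, ![1])).2 =
      (pencil s₀ s₁ s₂ n₀ n₁ n₂ n₃ (u, 0) (v, 0)).2 := by
    intro u v
    have h := hφ (φ.symm (u, 0)) (φ.symm (v, 0))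
    rw [LinearEquiv.apply_symm_apply, LinearEquiv.apply_symm_apply] at h
    refine ⟨(zmul ![D] (φ.symm (u, 0)) (φ.symm (v, 0))).2 0, ?_⟩
    rw [← h, ← Prod.smul_snd, ← map_smul]
    congr 2
    refine Prod.ext (by simp [zmul_apply]) (funext fun i => ?_)
    fin_cases i
    simp
  generalize (φ (0, ![1])).2 = z at key
  obtain ⟨c0, h0⟩ := key ![1, 0] ![1, 0]
  obtain ⟨c1, h1⟩ := key ![1, 0] ![0, 1]
  obtain ⟨c2, h2⟩ := key ![0, 1] ![1, 0]
  obtain ⟨c3, h3⟩ := key ![0, 1] ![0, 1]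
  have a0 := congrFun h0 0
  have a1 := congrFun h1 0
  have a2 := congrFun h2 0
  have a3 := congrFun h3 0
  have b1 := congrFun h1 1
  have b2 := congrFun h2 1
  simp [pencil, zmul_apply, Matrix.mulVec, dotProduct, Fin.sum_univ_two] at a0 a1 a2 a3 b1 b2
  have hc : c1 - c2 ≠ 0 := by
    intro hc
    refine hn ?_
    linear_combination b2 - b1 + hc * z 1
  have hz : z 0 = 0 := by
    refine (mul_eq_zero.1 ?_).resolve_left hc
    linear_combination a1 - a2
  rw [hz, mul_zero] at a0 a1 a3
  rcases hs with hs | hs | hs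
  · exact hs a0.symm
  · exact hs a1.symm
  · exact hs a3.symm

theorem projCongruent_iff_algIso {n : ℕ} {D D' : Matrix (Fin n) (Fin n) F} (hD' : D' ≠ 0) :
    ProjCongruent D D' ↔ AlgIso (zmul ![D]) (zmul ![D']) := by
  constructor
  · rintro ⟨P, c, hc, h⟩
    refine (zmul_algIso (P := P.1) (Q := !![c])
      ((Matrix.isUnit_iff_isUnit_det P.1).1 P.isUnit).ne_zero (by simpa using hc) fun i => ?_).symm
    fin_cases i
    simpa using h
  · intro h
    have hli : LinearIndependent F ![D'] := by
      rw [Fintype.linearIndependent_iff]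
      intro g hg i
      fin_cases i
      simpa [hD'] using hg
    obtain ⟨P, Q, hP, hQ, hPQ⟩ := exists_of_zmul_algIso hli h.symm
    refine ⟨Matrix.GeneralLinearGroup.mkOfDetNeZero P hP, Q 0 0, ?_, ?_⟩
    · simpa using hQ
    · simpa using hPQ 0

/-! ### The table -/

theorem AlgIso.of_transport_left {V V' W : Type*} [AddCommGroup V] [Module F V]
    [AddCommGroup V'] [Module F V'] [AddCommGroup W] [Module F W]
    {e : V ≃ₗ[F] W} {m : W →ₗ[F] W →ₗ[F] W} {m' : V' →ₗ[F] V' →ₗ[F] V'}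
    (h : AlgIso (transport e m) m') : AlgIso m m' :=
  (transport_algIso e m).symm.trans h

theorem AlgIso.of_transport_right {V V' W : Type*} [AddCommGroup V] [Module F V]
    [AddCommGroup V'] [Module F V'] [AddCommGroup W] [Module F W]
    {e : V ≃ₗ[F] W} {m : W →ₗ[F] W →ₗ[F] W} {m' : V' →ₗ[F] V' →ₗ[F] V'}
    (h : AlgIso m' (transport e m)) : AlgIso m' m :=
  h.trans (transport_algIso e m)

theorem AlgIso.transport_right {V V' W : Type*} [AddCommGroup V] [Module F V]
    [AddCommGroup V'] [Module F V'] [AddCommGroup W] [Module F W]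
    {e : V ≃ₗ[F] W} {m : W →ₗ[F] W →ₗ[F] W} {m' : V' →ₗ[F] V' →ₗ[F] V'}
    (h : AlgIso m' m) : AlgIso m' (NilpAlg.transport e m) :=
  h.trans (transport_algIso e m).symm

/-- The product of an algebra belonging to the subgroup with a given label. -/
def Label.mul : Label F → (Fin 4 → F) →ₗ[F] (Fin 4 → F) →ₗ[F] (Fin 4 → F)
  | .u2_one => mulU2 1
  | .u2_zero => mulU2 0
  | .u3_zero => transport splitTwo (pencil 1 0 0 0 0 1 0)
  | .u3_one => transport splitTwo (pencil 1 0 0 0 0 1 1)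
  | .u3_lam lam => transport splitTwo (pencil 1 0 0 0 1 lam 0)
  | .u4 ρ β₁ β₂ => transport splitTwo (pencil 1 0 ρ 0 1 β₁ β₂)
  | .u5 ε => transport splitTwo (pencil 0 1 0 1 1 0 ε)
  | .rd D => transport splitThree (zmul ![D])

theorem HasAlgebra.transport {n : ℕ} {V V' : Type*} [AddCommGroup V] [Module F V]
    [AddCommGroup V'] [Module F V'] {R : Subgroup (Matrix.GeneralLinearGroup (Fin (n + 1)) F)}
    {m : V →ₗ[F] V →ₗ[F] V} (h : HasAlgebra R m) (e : V' ≃ₗ[F] V) :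
    HasAlgebra R (transport e m) := by
  obtain ⟨m₁, h1, h2⟩ := h
  exact ⟨m₁, h1, h2.trans (transport_algIso e m).symm⟩

theorem Label.hasAlgebra : ∀ l : Label F, HasAlgebra l.group l.mul
  | .u2_one => hasAlgebra_U2 (1 : F)
  | .u2_zero => hasAlgebra_U2 (0 : F)
  -- `splitTwo` may replace `splitOdd` because `HasAlgebra` fixes the product only up to
  -- isomorphism.
  | .u3_zero => (hasAlgebra_U3 (0 : F) 1 0).transport splitTwo
  | .u3_one => (hasAlgebra_U3 (0 : F) 1 1).transport splitTwo
  | .u3_lam lam => (hasAlgebra_U3 (1 : F) lam 0).transport splitTwo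
  | .u4 ρ β₁ β₂ => (hasAlgebra_U4 ρ β₁ β₂).transport splitTwo
  | .u5 ε => (hasAlgebra_U5 (1 : F) 1 ε).transport splitTwo
  | .rd D => (hasAlgebra_RD D).transport splitThree

/-- The restrictions on the parameters of a label, before the choice of representatives. -/
def Label.Admissible : Label F → Prop
  | .u2_one => True
  | .u2_zero => True
  | .u3_zero => True
  | .u3_one => True
  | .u3_lam lam => lam ≠ 1
  | .u4 ρ β₁ _ => ρ ≠ 0 ∧ β₁ ≠ 1
  | .u5 _ => (2 : F) = 0
  | .rd D => ¬ D.IsSymm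

theorem pencil_noncomm {s₀ s₁ s₂ n₀ n₁ n₂ n₃ : F} (hn : n₁ ≠ n₂) :
    ∃ u v, pencil s₀ s₁ s₂ n₀ n₁ n₂ n₃ u v ≠ pencil s₀ s₁ s₂ n₀ n₁ n₂ n₃ v u := by
  refine ⟨(![1, 0], 0), (![0, 1], 0), fun h => hn ?_⟩
  have h1 := congrFun (Prod.ext_iff.1 h).2 1
  simpa [pencil, zmul_apply, Matrix.mulVec, dotProduct, Fin.sum_univ_two] using h1

theorem mulU2_noncomm (c : F) : ∃ u v, mulU2 c u v ≠ mulU2 c v u := by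
  refine ⟨![1, 0, 0, 0], ![0, 0, 1, 0], fun h => ?_⟩
  have h1 := congrFun h 3
  simp [mulU2_apply] at h1

theorem Label.Admissible.isNonabelian {l : Label F} (h : l.Admissible) :
    IsNonabelian l.group := by
  rw [l.hasAlgebra.isNonabelian_iff]
  cases l with
  | u2_one => exact mulU2_noncomm 1
  | u2_zero => exact mulU2_noncomm 0
  | u3_zero => exact (transport_algIso _ _).symm.noncomm (pencil_noncomm zero_ne_one)
  | u3_one => exact (transport_algIso _ _).symm.noncomm (pencil_noncomm zero_ne_one)
  | u3_lam lam => exact (transport_algIso _ _).symm.noncomm (pencil_noncomm (Ne.symm h))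
  | u4 ρ β₁ β₂ => exact (transport_algIso _ _).symm.noncomm (pencil_noncomm h.2.symm)
  | u5 ε => exact (transport_algIso _ _).symm.noncomm (pencil_noncomm one_ne_zero)
  | rd D => exact (transport_algIso _ _).symm.noncomm (zmul_noncomm_iff.2 h)

/-- Labels of the same kind with equivalent parameters. -/
def Label.Rel : Label F → Label F → Prop
  -- `DivRel` compares parameters only for a common `ρ`; for representatives in `Q` the first clause
  -- forces `ρ = ρ'`.
  | .u4 ρ β₁ β₂, .u4 ρ' β₁' β₂' => SquareRel ρ ρ' ∧ (ρ = ρ' → DivRel ρ (β₁, β₂) (β₁', β₂'))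
  | .u5 ε, .u5 ε' => ArtinSchreierRel ε ε'
  | .rd D, .rd D' => ProjCongruent D D'
  | l, l' => l = l'

theorem Label.eq_u2_of_algIso {c : F} : ∀ {l : Label F}, AlgIso (mulU2 c) l.mul →
    l = .u2_one ∨ l = .u2_zero
  | .u2_one, _ => Or.inl rfl
  | .u2_zero, _ => Or.inr rfl
  | .u3_zero, h => (not_mulU2_algIso_pencil (AlgIso.of_transport_right h)).elim
  | .u3_one, h => (not_mulU2_algIso_pencil (AlgIso.of_transport_right h)).elim
  | .u3_lam _, h => (not_mulU2_algIso_pencil (AlgIso.of_transport_right h)).elim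
  | .u4 _ _ _, h => (not_mulU2_algIso_pencil (AlgIso.of_transport_right h)).elim
  | .u5 _, h => (not_mulU2_algIso_pencil (AlgIso.of_transport_right h)).elim
  | .rd _, h => (not_mulU2_algIso_zmul (AlgIso.of_transport_right h)).elim

theorem Label.eq_rd_of_algIso {D : Matrix (Fin 3) (Fin 3) F} : ∀ {l : Label F}, l.Admissible →
    AlgIso (zmul ![D]) l.mul → ∃ D', l = .rd D'
  | .u2_one, _, h => (not_mulU2_algIso_zmul h.symm).elim
  | .u2_zero, _, h => (not_mulU2_algIso_zmul h.symm).elim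
  | .u3_zero, _, h => (not_zmul_one_algIso_pencil (Or.inl one_ne_zero) zero_ne_one
      (AlgIso.of_transport_right h)).elim
  | .u3_one, _, h => (not_zmul_one_algIso_pencil (Or.inl one_ne_zero) zero_ne_one
      (AlgIso.of_transport_right h)).elim
  | .u3_lam _, hl, h => (not_zmul_one_algIso_pencil (Or.inl one_ne_zero) (Ne.symm hl)
      (AlgIso.of_transport_right h)).elim
  | .u4 _ _ _, hl, h => (not_zmul_one_algIso_pencil (Or.inl one_ne_zero) hl.2.symm
      (AlgIso.of_transport_right h)).elim
  | .u5 _, _, h => (not_zmul_one_algIso_pencil (Or.inr (Or.inl one_ne_zero)) one_ne_zero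
      (AlgIso.of_transport_right h)).elim
  | .rd D', _, _ => ⟨D', rfl⟩

theorem Label.eq_u3_of_algIso {α γ₁ γ₃ : F} (hn : α ≠ γ₁) : ∀ {l : Label F}, l.Admissible →
    AlgIso (pencil 1 0 0 0 α γ₁ γ₃) l.mul → l = .u3_zero ∨ l = .u3_one ∨ ∃ lam, l = .u3_lam lam
  | .u2_one, _, h => (not_mulU2_algIso_pencil h.symm).elim
  | .u2_zero, _, h => (not_mulU2_algIso_pencil h.symm).elim
  | .u3_zero, _, _ => Or.inl rfl
  | .u3_one, _, _ => Or.inr (Or.inl rfl)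
  | .u3_lam lam, _, _ => Or.inr (Or.inr ⟨lam, rfl⟩)
  | .u4 _ _ _, hl, h =>
    (not_rankOne_algIso_rankTwo hl.1 hl.2.symm (AlgIso.of_transport_right h)).elim
  | .u5 _, _, h => (not_rankOne_algIso_alternating one_ne_zero (AlgIso.of_transport_right h)).elim
  | .rd _, _, h => (not_zmul_one_algIso_pencil (Or.inl one_ne_zero) hn
      (AlgIso.of_transport_right h).symm).elim

theorem Label.eq_u4_of_algIso {ρ β₁ β₂ : F} (hρ : ρ ≠ 0) (hβ : β₁ ≠ 1) : ∀ {l : Label F},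
    l.Admissible → AlgIso (pencil 1 0 ρ 0 1 β₁ β₂) l.mul → ∃ ρ' β₁' β₂', l = .u4 ρ' β₁' β₂'
  | .u2_one, _, h => (not_mulU2_algIso_pencil h.symm).elim
  | .u2_zero, _, h => (not_mulU2_algIso_pencil h.symm).elim
  | .u3_zero, _, h =>
    (not_rankOne_algIso_rankTwo hρ hβ.symm (AlgIso.of_transport_right h).symm).elim
  | .u3_one, _, h =>
    (not_rankOne_algIso_rankTwo hρ hβ.symm (AlgIso.of_transport_right h).symm).elim
  | .u3_lam _, _, h =>
    (not_rankOne_algIso_rankTwo hρ hβ.symm (AlgIso.of_transport_right h).symm).elim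
  | .u4 _ _ _, _, _ => ⟨_, _, _, rfl⟩
  | .u5 _, hl, h =>
    (not_alternating_algIso_diagonal hl hβ.symm (AlgIso.of_transport_right h).symm).elim
  | .rd _, _, h => (not_zmul_one_algIso_pencil (Or.inl one_ne_zero) hβ.symm
      (AlgIso.of_transport_right h).symm).elim

theorem Label.eq_u5_of_algIso {ε : F} (h2 : (2 : F) = 0) : ∀ {l : Label F},
    l.Admissible → AlgIso (pencil 0 1 0 1 1 0 ε) l.mul → ∃ ε', l = .u5 ε'
  | .u2_one, _, h => (not_mulU2_algIso_pencil h.symm).elim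
  | .u2_zero, _, h => (not_mulU2_algIso_pencil h.symm).elim
  | .u3_zero, _, h => (not_alternating_algIso_diagonal h2 zero_ne_one
      (AlgIso.of_transport_right h)).elim
  | .u3_one, _, h => (not_alternating_algIso_diagonal h2 zero_ne_one
      (AlgIso.of_transport_right h)).elim
  | .u3_lam _, hl, h => (not_alternating_algIso_diagonal h2 (Ne.symm hl)
      (AlgIso.of_transport_right h)).elim
  | .u4 _ _ _, hl, h => (not_alternating_algIso_diagonal h2 hl.2.symm
      (AlgIso.of_transport_right h)).elim
  | .u5 _, _, _ => ⟨_, rfl⟩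
  | .rd _, _, h => (not_zmul_one_algIso_pencil (Or.inr (Or.inl one_ne_zero)) one_ne_zero
      (AlgIso.of_transport_right h).symm).elim

theorem rankOne_invariants {α γ₁ γ₃ α' γ₁' γ₃' : F} (hn : α' ≠ γ₁')
    (h : AlgIso (pencil 1 0 0 0 α γ₁ γ₃) (pencil 1 0 0 0 α' γ₁' γ₃')) :
    (γ₃ = 0 ↔ γ₃' = 0) ∧ (γ₃ = 0 → γ₃' = 0 → α * γ₁' = γ₁ * α') := by
  obtain ⟨k, l, d, y, z, hk, hl, hd, e1, e2, e3⟩ := rankOne_unique hn h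
  refine ⟨⟨fun h0 => ?_, fun h0 => ?_⟩, fun h0 h0' => ?_⟩
  · rw [h0, zero_mul] at e1
    exact (mul_eq_zero.1 e1.symm).resolve_left hd
  · rw [h0, mul_zero] at e1
    exact (mul_eq_zero.1 e1).resolve_right hl
  · rw [h0, zero_mul, add_zero] at e2 e3
    refine mul_left_cancel₀ (mul_ne_zero hk hd) ?_
    linear_combination γ₁' * d * e2 - α' * d * e3

theorem Label.rel_of_algIso {l l' : Label F} (hl : l.Admissible) (hl' : l'.Admissible)
    (h : AlgIso l.mul l'.mul) : l.Rel l' := by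
  have h3 : ∀ {α γ₁ γ₃ α' γ₁' γ₃' : F}, α' ≠ γ₁' →
      AlgIso (transport splitTwo (pencil 1 0 0 0 α γ₁ γ₃))
        (transport splitTwo (pencil 1 0 0 0 α' γ₁' γ₃')) →
      (γ₃ = 0 ↔ γ₃' = 0) ∧ (γ₃ = 0 → γ₃' = 0 → α * γ₁' = γ₁ * α') := fun hn h =>
    rankOne_invariants hn (AlgIso.of_transport_left (AlgIso.of_transport_right h))
  cases l with
  | u2_one =>
    rcases Label.eq_u2_of_algIso h with rfl | rfl
    · exact rfl
    · exact (not_mulU2_zero_algIso_one h.symm).elim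
  | u2_zero =>
    rcases Label.eq_u2_of_algIso h with rfl | rfl
    · exact (not_mulU2_zero_algIso_one h).elim
    · exact rfl
  | u3_zero =>
    rcases Label.eq_u3_of_algIso zero_ne_one hl' (AlgIso.of_transport_left h) with
      rfl | rfl | ⟨lam, rfl⟩
    · exact rfl
    · exact (one_ne_zero ((h3 zero_ne_one h).1.1 rfl)).elim
    · have := (h3 (Ne.symm hl') h).2 rfl rfl
      simp at this
  | u3_one =>
    rcases Label.eq_u3_of_algIso zero_ne_one hl' (AlgIso.of_transport_left h) with
      rfl | rfl | ⟨lam, rfl⟩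
    · exact (one_ne_zero ((h3 zero_ne_one h).1.2 rfl)).elim
    · exact rfl
    · exact (one_ne_zero ((h3 (Ne.symm hl') h).1.2 rfl)).elim
  | u3_lam lam =>
    rcases Label.eq_u3_of_algIso (Ne.symm hl) hl' (AlgIso.of_transport_left h) with
      rfl | rfl | ⟨lam', rfl⟩
    · have := (h3 zero_ne_one h).2 rfl rfl
      simp at this
    · exact (one_ne_zero ((h3 zero_ne_one h).1.1 rfl)).elim
    · have := (h3 (Ne.symm hl') h).2 rfl rfl
      rw [one_mul, mul_one] at this
      rw [this]
      exact rfl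
  | u4 ρ β₁ β₂ =>
    obtain ⟨ρ', β₁', β₂', rfl⟩ := Label.eq_u4_of_algIso hl.1 hl.2 hl' (AlgIso.of_transport_left h)
    have h' := AlgIso.of_transport_left (AlgIso.of_transport_right h)
    refine ⟨squareRel_of_algIso hl'.2.symm h', ?_⟩
    rintro rfl
    exact divRel_of_algIso hl.1 hl'.2 h'
  | u5 ε =>
    obtain ⟨ε', rfl⟩ := Label.eq_u5_of_algIso hl hl' (AlgIso.of_transport_left h)
    exact artinSchreierRel_of_algIso (AlgIso.of_transport_left (AlgIso.of_transport_right h)).symm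
  | rd D =>
    obtain ⟨D', rfl⟩ := Label.eq_rd_of_algIso hl' (AlgIso.of_transport_left h)
    refine (projCongruent_iff_algIso ?_).2 (AlgIso.of_transport_left (AlgIso.of_transport_right h))
    rintro rfl
    exact hl' (by simp [Matrix.IsSymm])

end Classification

/-! ### Passage to the chosen representatives. -/

section Representatives

variable {F : Type*} [Field F] {Q : Set F} {A : F → Set (F × F)} {B : Set F}
  {P : Set (Matrix (Fin 3) (Fin 3) F)}

theorem Label.Cond.admissible (hQ : IsRepSet {a : F | a ≠ 0} SquareRel Q)
    (hA : ∀ ρ ∈ Q, IsRepSet {p : F × F | p.1 ≠ 1} (DivRel ρ) (A ρ))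
    (hP : IsRepSet {D : Matrix (Fin 3) (Fin 3) F | ¬ D.IsSymm} ProjCongruent P) :
    ∀ {l : Label F}, l.Cond Q A B P → l.Admissible
  | .u2_one, _ => trivial
  | .u2_zero, _ => trivial
  | .u3_zero, _ => trivial
  | .u3_one, _ => trivial
  | .u3_lam _, h => h
  | .u4 ρ _ _, h => ⟨hQ.1 h.1, (hA ρ h.1).1 h.2⟩
  | .u5 _, h => by
    have := h.1
    exact CharTwo.two_eq_zero
  | .rd _, h => hP.1 h

/-- Both `x` and `y` represent `x`. Reflexivity at `x` suffices, so the relations need not be shown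
to be equivalences. -/
theorem IsRepSet.eq_of_rel {α : Type*} {X S : Set α} {r : α → α → Prop} (h : IsRepSet X r S)
    {x y : α} (hx : x ∈ S) (hy : y ∈ S) (hxx : r x x) (hxy : r x y) : x = y :=
  (h.2 x (h.1 hx)).unique ⟨hx, hxx⟩ ⟨hy, hxy⟩

theorem Label.Cond.eq_of_rel (hQ : IsRepSet {a : F | a ≠ 0} SquareRel Q)
    (hA : ∀ ρ ∈ Q, IsRepSet {p : F × F | p.1 ≠ 1} (DivRel ρ) (A ρ))
    (hB : CharP F 2 → IsRepSet Set.univ ArtinSchreierRel B)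
    (hP : IsRepSet {D : Matrix (Fin 3) (Fin 3) F | ¬ D.IsSymm} ProjCongruent P)
    {l l' : Label F} (hl : l.Cond Q A B P) (hl' : l'.Cond Q A B P) (h : l.Rel l') : l = l' := by
  have h4 : ∀ {ρ β₁ β₂ ρ' β₁' β₂' : F}, (Label.u4 ρ β₁ β₂).Cond Q A B P →
      (Label.u4 ρ' β₁' β₂').Cond Q A B P → (Label.u4 ρ β₁ β₂).Rel (.u4 ρ' β₁' β₂') →
      Label.u4 ρ β₁ β₂ = .u4 ρ' β₁' β₂' := by
    rintro ρ β₁ β₂ ρ' β₁' β₂' ⟨hl1, hl2⟩ ⟨hl1', hl2'⟩ ⟨h1, h2⟩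
    obtain rfl : ρ = ρ' := hQ.eq_of_rel hl1 hl1' ⟨1, one_ne_zero, by ring⟩ h1
    obtain ⟨rfl, rfl⟩ := Prod.ext_iff.1
      ((hA ρ hl1).eq_of_rel hl2 hl2' (Or.inl ⟨rfl, Or.inl rfl⟩) (h2 rfl))
    rfl
  have h5 : ∀ {ε ε' : F}, (Label.u5 ε).Cond Q A B P → (Label.u5 ε').Cond Q A B P →
      ArtinSchreierRel ε ε' → Label.u5 ε = .u5 ε' := by
    rintro ε ε' hl hl' h
    rw [(hB hl.1).eq_of_rel hl.2 hl'.2 ⟨0, by ring⟩ h]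
  have hR : ∀ {D D' : Matrix (Fin 3) (Fin 3) F}, (Label.rd D).Cond Q A B P →
      (Label.rd D').Cond Q A B P → ProjCongruent D D' → Label.rd D = .rd D' := by
    intro D D' hl hl' h
    rw [hP.eq_of_rel hl hl' ⟨1, 1, one_ne_zero, by simp⟩ h]
  cases l <;> cases l' <;> first | exact h4 hl hl' h | exact h5 hl hl' h | exact hR hl hl' h | exact h

theorem exists_label (hQ : IsRepSet {a : F | a ≠ 0} SquareRel Q)
    (hA : ∀ ρ ∈ Q, IsRepSet {p : F × F | p.1 ≠ 1} (DivRel ρ) (A ρ))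
    (hB : CharP F 2 → IsRepSet Set.univ ArtinSchreierRel B)
    (hP : IsRepSet {D : Matrix (Fin 3) (Fin 3) F | ¬ D.IsSymm} ProjCongruent P)
    {V : Type*} [AddCommGroup V] [Module F V] [FiniteDimensional F V]
    {m : V →ₗ[F] V →ₗ[F] V} (assoc : ∀ u v w, m (m u v) w = m u (m v w))
    (hq : ∀ a, ∃ b, a + b + m a b = 0) (hV : Module.finrank F V = 4)
    (hnc : ∃ u v, m u v ≠ m v u) :
    ∃ l : Label F, l.Cond Q A B P ∧ AlgIso m l.mul := by
  rcases algebra_classification assoc hq hV hnc with (h | h) | ⟨D, hD, h⟩ |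
    ⟨s₀, s₁, s₂, n₀, n₁, n₂, n₃, hs, hn, h⟩
  · exact ⟨.u2_zero, trivial, h⟩
  · exact ⟨.u2_one, trivial, h⟩
  · obtain ⟨D', ⟨hD', hDD'⟩, -⟩ := hP.2 D hD
    have hne : D' ≠ 0 := by
      rintro rfl
      exact hP.1 hD' (by simp [Matrix.IsSymm])
    exact ⟨.rd D', hD', AlgIso.transport_right
      (h.trans ((projCongruent_iff_algIso hne).1 hDD'))⟩
  rcases exists_diagonal_or_alternating (n₀ := n₀) (n₃ := n₃) hs hn with
    ⟨ρ, a, b, c, hab, h'⟩ | ⟨h2, a, b, c, d, hbc, h'⟩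
  · by_cases hρ : ρ = 0
    · subst hρ
      rcases rankOne_normal_form (c := c) hab with h'' | h'' | ⟨lam, hlam, h''⟩
      · exact ⟨.u3_zero, trivial, AlgIso.transport_right (h.trans (h'.trans h''))⟩
      · exact ⟨.u3_one, trivial, AlgIso.transport_right (h.trans (h'.trans h''))⟩
      · exact ⟨.u3_lam lam, hlam, AlgIso.transport_right (h.trans (h'.trans h''))⟩
    · obtain ⟨q, ⟨hqQ, k, hk, hqk⟩, -⟩ := hQ.2 ρ hρ
      obtain ⟨β₁, β₂, hβ, h''⟩ := rankTwo_normal_form (c := c) hρ hk hqk hab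
      obtain ⟨⟨β₃, β₄⟩, ⟨hβ', hdiv⟩, -⟩ := (hA q hqQ).2 (β₁, β₂) hβ
      exact ⟨.u4 q β₃ β₄, ⟨hqQ, hβ'⟩,
        AlgIso.transport_right (h.trans (h'.trans (h''.trans hdiv.algIso)))⟩
  · have hchar : CharP F 2 := CharTwo.of_one_ne_zero_of_two_eq_zero one_ne_zero h2
    obtain ⟨ε, h''⟩ := alternating_normal_form (a := a) (d := d) h2 hbc
    obtain ⟨ε', ⟨hε', hrel⟩, -⟩ := (hB hchar).2 ε trivial
    exact ⟨.u5 ε', ⟨hchar, hε'⟩,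
      AlgIso.transport_right (h.trans (h'.trans (h''.trans (hrel.algIso h2))))⟩

end Representatives

end NilpAlg

theorem mainTheorem3 {F : Type*} [Field F]
    (Q : Set F) (hQ : NilpAlg.IsRepSet {a : F | a ≠ 0} NilpAlg.SquareRel Q)
    (A : F → Set (F × F))
    (hA : ∀ ρ ∈ Q, NilpAlg.IsRepSet {p : F × F | p.1 ≠ 1} (NilpAlg.DivRel ρ) (A ρ))
    (B : Set F) (hB : CharP F 2 → NilpAlg.IsRepSet Set.univ NilpAlg.ArtinSchreierRel B)
    (P : Set (Matrix (Fin 3) (Fin 3) F))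
    (hP : NilpAlg.IsRepSet {D : Matrix (Fin 3) (Fin 3) F | ¬ D.IsSymm} NilpAlg.ProjCongruent P) :
    (∀ l : NilpAlg.Label F, l.Cond Q A B P →
      l.group ∈ NilpAlg.Delta 4 F ∧ NilpAlg.IsNonabelian l.group) ∧
    (∀ R ∈ NilpAlg.Delta 4 F, NilpAlg.IsNonabelian R →
      ∃ l : NilpAlg.Label F, l.Cond Q A B P ∧ NilpAlg.AffConj R l.group) ∧
    (∀ l l' : NilpAlg.Label F, l.Cond Q A B P → l'.Cond Q A B P →
      NilpAlg.AffConj l.group l'.group → l = l') := by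
  refine ⟨fun l hl => ⟨l.hasAlgebra.mem_delta, (hl.admissible hQ hA hP).isNonabelian⟩, ?_, ?_⟩
  · intro R hR hnc
    obtain ⟨m, hm⟩ := NilpAlg.exists_isGroupOf hR
    obtain ⟨l, hl, h⟩ := NilpAlg.exists_label hQ hA hB hP hm.assoc hm.exists_quasiInverse
      (by simp) (hm.isNonabelian_iff.1 hnc)
    obtain ⟨m', hm', h'⟩ := l.hasAlgebra
    exact ⟨l, hl, hm.affConj_of_algIso hm' (h.trans h'.symm)⟩
  · intro l l' hl hl' h
    exact hl.eq_of_rel hQ hA hB hP hl' (NilpAlg.Label.rel_of_algIso (hl.admissible hQ hA hP)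
      (hl'.admissible hQ hA hP) (l.hasAlgebra.algIso l'.hasAlgebra h))
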